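/- Let $(a,b)\subset\mathbb{R}$ be a bounded nonempty open interval, let $m\ge 1$, $r\ge 1$, $n\ge 0$ be integers and $1\le p\le\infty$. Let $W^n_p=W^n_p([a,b];\mathbb{C})$ be the complex Sobolev space of all $u\in L_p(a,b)$ whose weak derivatives of orders $\le n$ belong to $L_p(a,b)$, normed by the sum of the $L_p$-norms of these derivatives ($W^0_p=L_p$); spaces of vectors and matrices over $W^n_p$ carry the topology of entrywise convergence. Fix $\varepsilon_0>0$. For each $\varepsilon\in[0,\varepsilon_0)$ let matrix-valued functions $A_{r-j}(\cdot;\varepsilon)\in(W^n_p)^{m\times m}$, $j\in\{1,\dots,r\}$, and a continuous linear operator $B(\varepsilon)\colon (W^{n+r}_p)^m\to\mathbb{C}^{rm}$ be chosen arbitrarily (no regularity in $\varepsilon$ is assumed). For $f(\cdot;\varepsilon)\in(W^n_p)^m$ and $c(\varepsilon)\in\mathbb{C}^{rm}$ consider the boundary-value problem $$L(\varepsilon)y(t;\varepsilon):=y^{(r)}(t;\varepsilon)+\sum_{j=1}^{r}A_{r-j}(t;\varepsilon)\,y^{(r-j)}(t;\varepsilon)=f(t;\varepsilon),\quad t\in(a,b),\qquad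 B(\varepsilon)y(\cdot;\varepsilon)=c(\varepsilon),$$ whose solutions are the functions $y(\cdot;\varepsilon)\in(W^{n+r}_p)^m$ that satisfy the differential equation almost everywhere on $(a,b)$ (for $n\ge 1$ equivalently everywhere, for the continuous representatives) and the boundary condition. We say that the solution depends continuously on the parameter $\varepsilon$ at $\varepsilon=0$ if there is a positive number $\varepsilon_1<\varepsilon_0$ such that - $(\ast)$ for every $\varepsilon\in[0,\varepsilon_1)$ and arbitrary $f(\cdot;\varepsilon)\in(W^n_p)^m$, $c(\varepsilon)\in\mathbb{C}^{rm}$ the problem has a unique solution $y(\cdot;\varepsilon)\in(W^{n+r}_p)^m$; - $(\ast\ast)$ whenever $f(\cdot;\varepsilon)\to f(\cdot;0)$ in $(W^n_p)^m$ and $c(\varepsilon)\to c(0)$ in $\mathbb{C}^{rm}$ as $\varepsilon\to0+$, the solutions satisfy $y(\cdot;\varepsilon)\to y(\cdot;0)$ in $(W^{n+r}_p)^m$ as $\varepsilon\to0+$. Theorem. The solution depends continuously on the parameter $\varepsilon$ at $\varepsilon=0$ if and only if the following three conditions hold: - (0) the homogeneous problem $L(0)y=0$ on $(a,b)$, $B(0)y=0$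 has only the trivial solution in $(W^{n+r}_p)^m$; - (I) $A_{r-j}(\cdot;\varepsilon)\to A_{r-j}(\cdot;0)$ in $(W^n_p)^{m\times m}$ as $\varepsilon\to0+$ for each $j\in\{1,\dots,r\}$; - (II) $B(\varepsilon)y\to B(0)y$ in $\mathbb{C}^{rm}$ as $\varepsilon\to0+$ for every $y\in(W^{n+r}_p)^m$. -/

import Mathlib

open MeasureTheory Set Filter Topology
open scoped ENNReal ContDiff

noncomputable section

namespace SobolevBVP

/-- Lebesgue measure on the interval `(a, b)`. -/
abbrev intervalMeasure (a b : ℝ) : Measure ℝ := volume.restrict (Ioo a b)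

/-- The complex Lebesgue space `L_p` on `(a, b)`. -/
abbrev LpSpace (a b : ℝ) (p : ℝ≥0∞) : Type := Lp ℂ p (intervalMeasure a b)

/-- Test functions on `(a, b)`: smooth functions with compact support contained in `(a, b)`. -/
structure IsTestFunction (a b : ℝ) (φ : ℝ → ℝ) : Prop where
  smooth : ContDiff ℝ ∞ φ
  compact : HasCompactSupport φ
  supp : tsupport φ ⊆ Ioo a b

/-- `v` is a weak (distributional) derivative of order `k` of `u` on `(a, b)`:
`∫ φ⁽ᵏ⁾ u = (-1)ᵏ ∫ φ v` for every test function `φ`. -/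
def HasWeakDeriv {a b : ℝ} {p : ℝ≥0∞} (k : ℕ) (u v : LpSpace a b p) : Prop :=
  ∀ φ : ℝ → ℝ, IsTestFunction a b φ →
    ∫ t in Ioo a b, iteratedDeriv k φ t • u t = (-1 : ℂ) ^ k * ∫ t in Ioo a b, φ t • v t

section WeakDeriv

variable {a b : ℝ} {p : ℝ≥0∞} [Fact (1 ≤ p)] {k : ℕ}

lemma integrable_coe (u : LpSpace a b p) : Integrable u (intervalMeasure a b) :=
  (Lp.memLp u).integrable Fact.out

lemma integrable_test_smul {φ : ℝ → ℝ} (hφ : IsTestFunction a b φ) (k : ℕ) (u : LpSpace a b p) :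
    Integrable (fun t => iteratedDeriv k φ t • u t) (intervalMeasure a b) := by
  have hc : Continuous (iteratedDeriv k φ) :=
    hφ.smooth.continuous_iteratedDeriv k (by exact_mod_cast le_top)
  have hs : HasCompactSupport (iteratedDeriv k φ) := by
    induction k with
    | zero => simpa using hφ.compact
    | succ k ih =>
      rw [iteratedDeriv_succ]
      exact (ih (hφ.smooth.continuous_iteratedDeriv k (by exact_mod_cast le_top))).deriv
  obtain ⟨C, hC⟩ := hs.exists_bound_of_continuous hc
  exact (integrable_coe u).bdd_smul C hc.aestronglyMeasurable (Eventually.of_forall hC)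

lemma integrable_smul {φ : ℝ → ℝ} (hφ : IsTestFunction a b φ) (u : LpSpace a b p) :
    Integrable (fun t => φ t • u t) (intervalMeasure a b) := by
  simpa using integrable_test_smul hφ 0 u

lemma HasWeakDeriv.add {u u' v v' : LpSpace a b p} (h : HasWeakDeriv k u v)
    (h' : HasWeakDeriv k u' v') : HasWeakDeriv k (u + u') (v + v') := by
  intro φ hφ
  have e1 : ∫ t in Ioo a b, iteratedDeriv k φ t • (u + u') t
      = ∫ t in Ioo a b, (iteratedDeriv k φ t • u t + iteratedDeriv k φ t • u' t) := by
    refine integral_congr_ae ?_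
    filter_upwards [Lp.coeFn_add u u'] with t ht
    rw [ht, Pi.add_apply, smul_add]
  have e2 : ∫ t in Ioo a b, φ t • (v + v') t
      = ∫ t in Ioo a b, (φ t • v t + φ t • v' t) := by
    refine integral_congr_ae ?_
    filter_upwards [Lp.coeFn_add v v'] with t ht
    rw [ht, Pi.add_apply, smul_add]
  rw [e1, e2, integral_add (integrable_test_smul hφ k u) (integrable_test_smul hφ k u'),
    integral_add (integrable_smul hφ v) (integrable_smul hφ v'), h φ hφ, h' φ hφ, mul_add]

lemma HasWeakDeriv.smul {u v : LpSpace a b p} (z : ℂ) (h : HasWeakDeriv k u v) :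
    HasWeakDeriv k (z • u) (z • v) := by
  intro φ hφ
  have e1 : ∫ t in Ioo a b, iteratedDeriv k φ t • (z • u) t
      = ∫ t in Ioo a b, z • (iteratedDeriv k φ t • u t) := by
    refine integral_congr_ae ?_
    filter_upwards [Lp.coeFn_smul z u] with t ht
    rw [ht, Pi.smul_apply, smul_comm]
  have e2 : ∫ t in Ioo a b, φ t • (z • v) t
      = ∫ t in Ioo a b, z • (φ t • v t) := by
    refine integral_congr_ae ?_
    filter_upwards [Lp.coeFn_smul z v] with t ht
    rw [ht, Pi.smul_apply, smul_comm]
  rw [e1, e2, integral_smul, integral_smul, h φ hφ, smul_eq_mul, smul_eq_mul]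
  ring

lemma hasWeakDeriv_zero (k : ℕ) : HasWeakDeriv k (0 : LpSpace a b p) 0 := by
  have h0 : HasWeakDeriv k ((0 : ℂ) • (0 : LpSpace a b p)) ((0 : ℂ) • 0) := by
    intro φ _
    have e : ∀ ψ : ℝ → ℝ, ∫ t in Ioo a b, ψ t • ((0 : ℂ) • (0 : LpSpace a b p)) t = 0 := by
      intro ψ
      refine integral_eq_zero_of_ae ?_
      filter_upwards [Lp.coeFn_smul (0 : ℂ) (0 : LpSpace a b p)] with t ht
      rw [ht]; simp
    rw [e, e, mul_zero]
  simpa using h0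

/-- Weak derivatives are unique. -/
lemma HasWeakDeriv.unique {u v v' : LpSpace a b p} (h : HasWeakDeriv k u v)
    (h' : HasWeakDeriv k u v') : v = v' := by
  have key : ∀ᵐ t ∂(volume : Measure ℝ), t ∈ Ioo a b → (v t - v' t) = 0 := by
    refine isOpen_Ioo.ae_eq_zero_of_integral_contDiff_smul_eq_zero (f := fun t => v t - v' t) ?_ ?_
    · exact IntegrableOn.locallyIntegrableOn ((integrable_coe v).sub (integrable_coe v'))
    · intro φ h1 h2 h3
      have hφ : IsTestFunction a b φ := ⟨h1, h2, h3⟩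
      have hz : ((-1 : ℂ) ^ k) ≠ 0 := pow_ne_zero _ (by norm_num)
      have e := mul_left_cancel₀ hz ((h φ hφ).symm.trans (h' φ hφ))
      have : ∫ t, φ t • (v t - v' t) = ∫ t in Ioo a b, φ t • (v t - v' t) := by
        refine (setIntegral_eq_integral_of_forall_compl_eq_zero ?_).symm
        intro t ht
        rw [image_eq_zero_of_notMem_tsupport (fun hh => ht (h3 hh)), zero_smul]
      rw [this]
      simp only [smul_sub]
      rw [integral_sub (integrable_smul hφ v) (integrable_smul hφ v'), e, sub_self]
  refine Lp.ext ?_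
  rw [Filter.EventuallyEq, ae_restrict_iff' measurableSet_Ioo]
  filter_upwards [key] with t ht hm using sub_eq_zero.1 (ht hm)

lemma hasWeakDeriv_self (u : LpSpace a b p) : HasWeakDeriv 0 u u := by
  intro φ _
  simp

end WeakDeriv

/-- The weak derivative of order `k` of `u` when it exists as an element of `L_p`
(and `0` otherwise; below it is only used where it exists). -/
def weakDeriv {a b : ℝ} {p : ℝ≥0∞} (k : ℕ) (u : LpSpace a b p) : LpSpace a b p :=
  open Classical in if h : ∃ v, HasWeakDeriv k u v then h.choose else 0

/-- The Sobolev space `W^n_p` on `(a, b)` as a subspace of `L_p`: all `u` whose weak derivatives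
of all orders `k ≤ n` exist and belong to `L_p`. -/
def sobolevSubmodule (a b : ℝ) (p : ℝ≥0∞) [Fact (1 ≤ p)] (n : ℕ) :
    Submodule ℂ (LpSpace a b p) where
  carrier := {u | ∀ k ≤ n, ∃ v, HasWeakDeriv k u v}
  add_mem' := fun {u u'} hu hu' k hk => by
    obtain ⟨v, hv⟩ := hu k hk
    obtain ⟨v', hv'⟩ := hu' k hk
    exact ⟨v + v', hv.add hv'⟩
  zero_mem' := fun k _ => ⟨0, hasWeakDeriv_zero k⟩
  smul_mem' := fun z u hu k hk => by
    obtain ⟨v, hv⟩ := hu k hk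
    exact ⟨z • v, hv.smul z⟩

/-- The Sobolev space `W^n_p` as a type of its own, to be normed by the Sobolev norm. -/
def SobolevSpace (a b : ℝ) (p : ℝ≥0∞) [Fact (1 ≤ p)] (n : ℕ) : Type :=
  ↥(sobolevSubmodule a b p n)

namespace SobolevSpace

variable {a b : ℝ} {p : ℝ≥0∞} [Fact (1 ≤ p)] {n : ℕ}

instance : AddCommGroup (SobolevSpace a b p n) :=
  inferInstanceAs (AddCommGroup ↥(sobolevSubmodule a b p n))

instance : Module ℂ (SobolevSpace a b p n) :=
  inferInstanceAs (Module ℂ ↥(sobolevSubmodule a b p n))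

/-- The inclusion of `W^n_p` into `L_p`. -/
def toLp : SobolevSpace a b p n →ₗ[ℂ] LpSpace a b p :=
  (sobolevSubmodule a b p n).subtype

lemma toLp_injective : Function.Injective (toLp : SobolevSpace a b p n → LpSpace a b p) :=
  Subtype.val_injective

/-- The `k`-th (weak) derivative of an element of `W^n_p`; meaningful for `k ≤ n`. -/
def deriv (k : ℕ) (u : SobolevSpace a b p n) : LpSpace a b p := weakDeriv k (toLp u)

lemma hasWeakDeriv_deriv {k : ℕ} (hk : k ≤ n) (u : SobolevSpace a b p n) :
    HasWeakDeriv k (toLp u) (deriv k u) := by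
  have h : ∃ v, HasWeakDeriv k (toLp u) v := u.2 k hk
  rw [deriv, weakDeriv, dif_pos h]
  exact h.choose_spec

lemma deriv_add {k : ℕ} (hk : k ≤ n) (u v : SobolevSpace a b p n) :
    deriv k (u + v) = deriv k u + deriv k v := by
  refine (hasWeakDeriv_deriv hk (u + v)).unique ?_
  rw [map_add]
  exact (hasWeakDeriv_deriv hk u).add (hasWeakDeriv_deriv hk v)

lemma deriv_smul {k : ℕ} (hk : k ≤ n) (z : ℂ) (u : SobolevSpace a b p n) :
    deriv k (z • u) = z • deriv k u := by
  refine (hasWeakDeriv_deriv hk (z • u)).unique ?_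
  rw [map_smul]
  exact (hasWeakDeriv_deriv hk u).smul z

lemma deriv_zero_eq (u : SobolevSpace a b p n) : deriv 0 u = toLp u :=
  (hasWeakDeriv_deriv (Nat.zero_le n) u).unique (hasWeakDeriv_self _)

/-- The Sobolev norm: the sum of the `L_p` norms of the derivatives of orders `0, …, n`. -/
instance : Norm (SobolevSpace a b p n) :=
  ⟨fun u => ∑ k ∈ Finset.range (n + 1), ‖deriv k u‖⟩

lemma norm_def (u : SobolevSpace a b p n) :
    ‖u‖ = ∑ k ∈ Finset.range (n + 1), ‖deriv k u‖ := rfl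

lemma normCore : NormedSpace.Core ℂ (SobolevSpace a b p n) where
  norm_nonneg u := Finset.sum_nonneg fun _ _ => norm_nonneg _
  norm_smul z u := by
    rw [norm_def, norm_def, Finset.mul_sum]
    refine Finset.sum_congr rfl fun k hk => ?_
    rw [deriv_smul (Nat.lt_succ_iff.1 (Finset.mem_range.1 hk)), norm_smul]
  norm_triangle u v := by
    rw [norm_def, norm_def, norm_def, ← Finset.sum_add_distrib]
    refine Finset.sum_le_sum fun k hk => ?_
    rw [deriv_add (Nat.lt_succ_iff.1 (Finset.mem_range.1 hk))]
    exact norm_add_le _ _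
  norm_eq_zero_iff u := by
    constructor
    · intro h
      have h0 := (Finset.sum_eq_zero_iff_of_nonneg fun _ _ => norm_nonneg _).1 h 0 (by simp)
      rw [deriv_zero_eq, norm_eq_zero] at h0
      exact toLp_injective (h0.trans (map_zero _).symm)
    · rintro rfl
      refine Finset.sum_eq_zero fun k hk => ?_
      have := deriv_smul (Nat.lt_succ_iff.1 (Finset.mem_range.1 hk)) 0
        (0 : SobolevSpace a b p n)
      rw [zero_smul, zero_smul] at this
      rw [this, norm_zero]

instance : NormedAddCommGroup (SobolevSpace a b p n) := NormedAddCommGroup.ofCore normCore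

instance : NormedSpace ℂ (SobolevSpace a b p n) := NormedSpace.ofCore normCore

end SobolevSpace

/-- Vector-valued functions in `(W^n_p)^m`, with the product topology. -/
abbrev VecSobolev (a b : ℝ) (p : ℝ≥0∞) [Fact (1 ≤ p)] (n m : ℕ) : Type :=
  Fin m → SobolevSpace a b p n

/-- Matrix-valued functions in `(W^n_p)^{m×m}`, with the topology of entrywise convergence. -/
abbrev MatSobolev (a b : ℝ) (p : ℝ≥0∞) [Fact (1 ≤ p)] (n m : ℕ) : Type :=
  Matrix (Fin m) (Fin m) (SobolevSpace a b p n)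

section Problem

variable {a b : ℝ} {p : ℝ≥0∞} [Fact (1 ≤ p)] {n m r : ℕ}

/-- The vector `y⁽ᵏ⁾(t)`. -/
def vecDeriv (k : ℕ) (y : VecSobolev a b p n m) (t : ℝ) : Fin m → ℂ :=
  fun i => (y i).deriv k t

/-- The matrix `A(t)`. -/
def matValue (A : MatSobolev a b p n m) (t : ℝ) : Matrix (Fin m) (Fin m) ℂ :=
  A.map fun u => u.toLp t

/-- The differential expression
`(L y)(t) = y⁽ʳ⁾(t) + ∑_{j = 0}^{r - 1} A_j(t) y⁽ʲ⁾(t)`. -/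
def diffExpr (A : Fin r → MatSobolev a b p n m) (y : VecSobolev a b p (n + r) m) (t : ℝ) :
    Fin m → ℂ :=
  vecDeriv r y t + ∑ j : Fin r, (matValue (A j) t).mulVec (vecDeriv (j : ℕ) y t)

/-- `y ∈ (W^{n+r}_p)^m` solves the boundary-value problem `L y = f` on `(a, b)`, `B y = c`.
Elements of Sobolev spaces are classes modulo equality almost everywhere, and so the differential
equation is an equality almost everywhere; for `n ≥ 1` this is the same as equality
everywhere of the continuous representatives. -/
def IsSolution (A : Fin r → MatSobolev a b p n m)
    (B : VecSobolev a b p (n + r) m →L[ℂ] (Fin (r * m) → ℂ))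
    (f : VecSobolev a b p n m) (c : Fin (r * m) → ℂ) (y : VecSobolev a b p (n + r) m) : Prop :=
  (∀ᵐ t ∂(intervalMeasure a b), diffExpr A y t = vecDeriv 0 f t) ∧ B y = c

/-- Continuous dependence of the solution on the parameter `ε ∈ [0, ε₀)` at `ε = 0`: unique
solvability for all `ε ∈ [0, ε₁)` with some `0 < ε₁ < ε₀`, and convergence of the solutions
in `(W^{n+r}_p)^m` as `ε → 0+` whenever the right-hand sides converge. -/
def DependsContinuously (ε₀ : ℝ) (A : ℝ → Fin r → MatSobolev a b p n m)
    (B : ℝ → (VecSobolev a b p (n + r) m →L[ℂ] (Fin (r * m) → ℂ))) : Prop :=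
  ∃ ε₁ : ℝ, 0 < ε₁ ∧ ε₁ < ε₀ ∧
    (∀ ε ∈ Ico 0 ε₁, ∀ (f : VecSobolev a b p n m) (c : Fin (r * m) → ℂ),
      ∃! y, IsSolution (A ε) (B ε) f c y) ∧
    (∀ (f : ℝ → VecSobolev a b p n m) (c : ℝ → Fin (r * m) → ℂ)
      (y : ℝ → VecSobolev a b p (n + r) m),
      (∀ ε ∈ Ico 0 ε₁, IsSolution (A ε) (B ε) (f ε) (c ε) (y ε)) →
      Tendsto f (𝓝[>] 0) (𝓝 (f 0)) → Tendsto c (𝓝[>] 0) (𝓝 (c 0)) →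
      Tendsto y (𝓝[>] 0) (𝓝 (y 0)))

/-- The homogeneous problem has only the trivial solution. -/
def OnlyTrivialSolution (A : Fin r → MatSobolev a b p n m)
    (B : VecSobolev a b p (n + r) m →L[ℂ] (Fin (r * m) → ℂ)) : Prop :=
  ∀ y, IsSolution A B 0 0 y → y = 0

end Problem

end SobolevBVP

end

set_option linter.unusedSectionVars false

noncomputable section

namespace SobolevBVP

/-! Write `L(ε)` for `diffOp hab (A ε)`, a bounded operator from `(W^{n+r}_p)^m` to `(W^n_p)^m`. It
is bounded, and continuous in its coefficients for the operator norm, because the coefficients only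
multiply derivatives of order below `r`. These derivatives lie in `W^{n+1}_p`, and multiplication
`W^n_p × W^{n+1}_p → W^n_p` is bounded (`exists_mul`).

Sufficiency. The Cauchy problem is solvable (`exists_cauchy_solution`), so the homogeneous equation
has solutions with arbitrary Cauchy data, an `rm`-dimensional space of them. On this space `B(0)` is
injective by (0), hence onto `ℂ^{rm}`, and `(L(0), B(0))` is bijective
(`OnlyTrivialSolution.bijective`). By (I), `L(ε)` converges in norm, so `(L(ε), B(0))` is eventually
invertible with convergent inverses. `B(ε)` converges only strongly. However, exchanging `B(0)` for
`B(ε)` amounts to inverting an `rm × rm` matrix, and that matrix tends to the identity, since strong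
and norm convergence agree on a finite-dimensional space (`eventually_bijective_and_tendsto`).

Necessity. Condition (0) is uniqueness at `ε = 0`. For (I), fix `y` and let `w(ε)` solve the problem
with the constant data `L(0)y`, `B(0)y`, so that `w(ε) → y`. Then `(L(ε) - L(0))y = -L(0)(w - y) -
(L(ε) - L(0))(w - y)` is `o(1 + d(ε))`, where `d(ε)` is the total distance of the coefficients
(`coeffDist`). Taking monomials for `y` isolates the coefficients one order after another
(`isLittleO_coeff`). Hence `d = o(1 + d)`, which forces `d` to be bounded and then to vanish in the
limit. For (II), let `Q(ε)c` solve the homogeneous equation with boundary data `c`. Then `Q(ε)B(ε)y`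
is `y` minus the solution with data `L(ε)y` and `0`, so it converges by (I). Because `Q(ε) → Q(0)`
in norm and `Q(0)` is injective on a finite-dimensional space, `B(ε)y` converges too
(`tendsto_of_tendsto_clm_apply`). -/

/-! ### Integration by parts for primitives of integrable functions. -/

/-- The product rule for primitives of integrable functions. -/
lemma integral_primitive_mul_add {a T : ℝ} (haT : a ≤ T) {g h : ℝ → ℂ}
    (hg : IntervalIntegrable g volume a T) (hh : IntervalIntegrable h volume a T) :
    ∫ t in a..T, ((∫ s in a..t, g s) * h t + g t * ∫ s in a..t, h s)
      = (∫ t in a..T, g t) * ∫ t in a..T, h t := by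
  set μ : Measure ℝ := volume.restrict (Ioc a T) with hμ
  have hg' : Integrable g μ := (intervalIntegrable_iff_integrableOn_Ioc_of_le haT).1 hg
  have hh' : Integrable h μ := (intervalIntegrable_iff_integrableOn_Ioc_of_le haT).1 hh
  have hF : Integrable (fun z : ℝ × ℝ => g z.1 * h z.2) (μ.prod μ) := hg'.mul_prod hh'
  -- Fubini: the diagonal cuts the square into two triangles, and each summand of the integrand is
  -- an iterated integral of `g ⊗ h` over one of them.
  have hS : MeasurableSet {z : ℝ × ℝ | z.1 ≤ z.2} := measurableSet_le measurable_fst measurable_snd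
  have e1 : ∫ z in {z : ℝ × ℝ | z.1 ≤ z.2}, g z.1 * h z.2 ∂(μ.prod μ)
      = ∫ t in a..T, (∫ s in a..t, g s) * h t := by
    rw [← integral_indicator hS, integral_prod_symm _ (hF.indicator hS),
      intervalIntegral.integral_of_le haT]
    refine setIntegral_congr_fun measurableSet_Ioc fun t ht => ?_
    have : ∀ s, indicator {z : ℝ × ℝ | z.1 ≤ z.2} (fun z => g z.1 * h z.2) (s, t)
        = indicator (Iic t) g s * h t := by
      intro s
      by_cases hs : s ≤ t <;> simp [indicator, hs]
    simp only [this]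
    rw [integral_mul_const, integral_indicator measurableSet_Iic, hμ,
      Measure.restrict_restrict measurableSet_Iic, intervalIntegral.integral_of_le ht.1.le]
    congr 3
    ext s
    simp only [mem_inter_iff, mem_Iic, mem_Ioc]
    exact ⟨fun h => ⟨h.2.1, h.1⟩, fun h => ⟨h.2, h.1, h.2.trans ht.2⟩⟩
  have e2 : ∫ z in {z : ℝ × ℝ | z.1 ≤ z.2}ᶜ, g z.1 * h z.2 ∂(μ.prod μ)
      = ∫ t in a..T, g t * ∫ s in a..t, h s := by
    rw [← integral_indicator hS.compl, integral_prod _ (hF.indicator hS.compl),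
      intervalIntegral.integral_of_le haT]
    refine setIntegral_congr_fun measurableSet_Ioc fun t ht => ?_
    have : ∀ s, indicator {z : ℝ × ℝ | z.1 ≤ z.2}ᶜ (fun z => g z.1 * h z.2) (t, s)
        = g t * indicator (Iio t) h s := by
      intro s
      by_cases hs : t ≤ s <;> simp [indicator, hs]
    simp only [this]
    rw [integral_const_mul, integral_indicator measurableSet_Iio, hμ,
      Measure.restrict_restrict measurableSet_Iio, intervalIntegral.integral_of_le ht.1.le,
      integral_Ioc_eq_integral_Ioo]
    congr 3
    ext s
    simp only [mem_inter_iff, mem_Iio, mem_Ioc, mem_Ioo]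
    exact ⟨fun h => ⟨h.2.1, h.1⟩, fun h => ⟨h.2, h.1, h.2.le.trans ht.2⟩⟩
  have hcg : ContinuousOn (fun t => ∫ s in a..t, g s) (uIcc a T) :=
    intervalIntegral.continuousOn_primitive_interval (by
      rw [uIcc_of_le haT]; exact (intervalIntegrable_iff_integrableOn_Icc_of_le haT).1 hg)
  have hch : ContinuousOn (fun t => ∫ s in a..t, h s) (uIcc a T) :=
    intervalIntegral.continuousOn_primitive_interval (by
      rw [uIcc_of_le haT]; exact (intervalIntegrable_iff_integrableOn_Icc_of_le haT).1 hh)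
  rw [intervalIntegral.integral_add (hh.continuousOn_mul hcg) (hg.mul_continuousOn hch), ← e1,
    ← e2, integral_add_compl hS hF, integral_prod_mul, intervalIntegral.integral_of_le haT,
    intervalIntegral.integral_of_le haT]

/-! ### Test functions and their primitives. -/

namespace IsTestFunction

variable {a b : ℝ} {φ η : ℝ → ℝ}

lemma eq_zero_of_notMem (hφ : IsTestFunction a b φ) {t : ℝ} (ht : t ∉ Ioo a b) : φ t = 0 :=
  image_eq_zero_of_notMem_tsupport fun h => ht (hφ.supp h)

lemma deriv (hφ : IsTestFunction a b φ) : IsTestFunction a b (deriv φ) where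
  smooth := (contDiff_infty_iff_deriv.1 hφ.smooth).2
  compact := hφ.compact.deriv
  supp := tsupport_deriv_subset.trans hφ.supp

lemma iteratedDeriv (hφ : IsTestFunction a b φ) (k : ℕ) :
    IsTestFunction a b (iteratedDeriv k φ) := by
  induction k with
  | zero => simpa using hφ
  | succ k ih => rw [iteratedDeriv_succ]; exact ih.deriv

lemma sub_const_mul (hφ : IsTestFunction a b φ) (hη : IsTestFunction a b η) (c : ℝ) :
    IsTestFunction a b (fun t => φ t - c * η t) where
  smooth := hφ.smooth.sub (contDiff_const.mul hη.smooth)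
  compact := hφ.compact.sub (hη.compact.mul_left (f := fun _ => c))
  supp := by
    refine (tsupport_sub φ (fun t => c * η t)).trans (union_subset hφ.supp ?_)
    exact (tsupport_mul_subset_right (f := fun _ => c) (g := η)).trans hη.supp

lemma hasDerivAt (hφ : IsTestFunction a b φ) (t : ℝ) : HasDerivAt φ (_root_.deriv φ t) t :=
  ((hφ.smooth.differentiable (by simp)) t).hasDerivAt

lemma integral_deriv (hφ : IsTestFunction a b φ) (t : ℝ) :
    ∫ s in a..t, ((_root_.deriv φ s : ℝ) : ℂ) = (φ t : ℂ) := by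
  rw [intervalIntegral.integral_eq_sub_of_hasDerivAt
    (f := fun s => (φ s : ℂ)) (fun s _ => (hφ.hasDerivAt s).ofReal_comp)
    ((Complex.continuous_ofReal.comp hφ.deriv.smooth.continuous).intervalIntegrable _ _),
    hφ.eq_zero_of_notMem (t := a) (by simp)]
  simp

/-- A test function with zero mean is the derivative of a test function. -/
lemma exists_primitive (hab : a < b) (hη : IsTestFunction a b η) (h0 : ∫ t in a..b, η t = 0) :
    ∃ φ, IsTestFunction a b φ ∧ _root_.deriv φ = η := by
  have hc := hη.smooth.continuous
  -- The midpoint is adjoined so that `K` is nonempty even when `η = 0`.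
  set K : Set ℝ := insert ((a + b) / 2) (tsupport η) with hK
  have hKc : IsCompact K := hη.compact.isCompact.insert _
  have hKs : K ⊆ Ioo a b := insert_subset ⟨by linarith, by linarith⟩ hη.supp
  obtain ⟨c, hcK, hcl⟩ := hKc.exists_isLeast (insert_nonempty _ _)
  obtain ⟨d, hdK, hdg⟩ := hKc.exists_isGreatest (insert_nonempty _ _)
  have hlow : ∀ t, t < c → η t = 0 := fun t ht =>
    image_eq_zero_of_notMem_tsupport fun h => (hcl (mem_insert_of_mem _ h)).not_gt ht
  have hhigh : ∀ t, d < t → η t = 0 := fun t ht =>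
    image_eq_zero_of_notMem_tsupport fun h => (hdg (mem_insert_of_mem _ h)).not_gt ht
  set φ : ℝ → ℝ := fun t => ∫ s in a..t, η s with hφ
  have hd : ∀ t, HasDerivAt φ (η t) t := fun t => hc.integral_hasStrictDerivAt a t |>.hasDerivAt
  have hder : _root_.deriv φ = η := funext fun t => (hd t).deriv
  have hout : ∀ t, t ∉ Icc c d → φ t = 0 := by
    intro t ht
    rcases lt_or_ge t c with h | h
    · refine intervalIntegral.integral_zero_ae (Eventually.of_forall fun s hs => hlow s ?_)
      exact (hs.2).trans_lt (max_lt (hKs hcK).1 h)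
    · have hdt : d < t := lt_of_not_ge fun h' => ht ⟨h, h'⟩
      have : φ t = (∫ s in a..b, η s) + ∫ s in b..t, η s :=
        (intervalIntegral.integral_add_adjacent_intervals (hc.intervalIntegrable _ _)
          (hc.intervalIntegrable _ _)).symm
      rw [this, h0, zero_add]
      refine intervalIntegral.integral_zero_ae (Eventually.of_forall fun s hs => hhigh s ?_)
      exact (lt_min (hKs hdK).2 hdt).trans hs.1
  refine ⟨φ, ⟨?_, HasCompactSupport.intro isCompact_Icc hout, ?_⟩, hder⟩
  · exact contDiff_infty_iff_deriv.2 ⟨fun t => (hd t).differentiableAt, hder ▸ hη.smooth⟩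
  · refine (closure_minimal (fun t ht => ?_) isClosed_Icc).trans
      (fun t ht => ⟨(hKs hcK).1.trans_le ht.1, ht.2.trans_lt (hKs hdK).2⟩ : Icc c d ⊆ Ioo a b)
    by_contra h
    exact ht (hout t h)

lemma exists_integral_eq_one (hab : a < b) :
    ∃ ψ, IsTestFunction a b ψ ∧ ∫ t in a..b, ψ t = 1 := by
  let f : ContDiffBump ((a + b) / 2) := ⟨(b - a) / 8, (b - a) / 4, by linarith, by linarith⟩
  have hs : tsupport (f.normed volume) ⊆ Ioo a b := by
    rw [f.tsupport_normed_eq, Real.closedBall_eq_Icc]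
    intro t ht
    have h1 : (a + b) / 2 - (b - a) / 4 ≤ t := ht.1
    have h2 : t ≤ (a + b) / 2 + (b - a) / 4 := ht.2
    exact ⟨by linarith, by linarith⟩
  have h : IsTestFunction a b (f.normed volume) :=
    ⟨f.contDiff_normed, f.hasCompactSupport_normed, hs⟩
  refine ⟨_, h, ?_⟩
  rw [intervalIntegral.integral_of_le hab.le, integral_Ioc_eq_integral_Ioo,
    setIntegral_eq_integral_of_forall_compl_eq_zero fun t ht => h.eq_zero_of_notMem ht,
    f.integral_normed]

end IsTestFunction

/-! ### First-order weak derivatives as primitives. -/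

section WeakCalculus

variable {a b : ℝ} {p : ℝ≥0∞} [Fact (1 ≤ p)] {k j : ℕ} {u v w : LpSpace a b p}

lemma setIntegral_Ioo_eq (hab : a ≤ b) (f : ℝ → ℂ) : ∫ t in Ioo a b, f t = ∫ t in a..b, f t := by
  rw [intervalIntegral.integral_of_le hab, integral_Ioc_eq_integral_Ioo]

lemma intervalIntegrable_coe (hab : a ≤ b) (u : LpSpace a b p) :
    IntervalIntegrable u volume a b := by
  rw [intervalIntegrable_iff_integrableOn_Ioo_of_le hab]
  exact integrable_coe u

lemma intervalIntegrable_coe_of_mem (u : LpSpace a b p) {t : ℝ} (ht : t ∈ Icc a b) :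
    IntervalIntegrable u volume a t :=
  (intervalIntegrable_coe (ht.1.trans ht.2) u).mono_set (by
    rw [uIcc_of_le ht.1, uIcc_of_le (ht.1.trans ht.2)]; exact Icc_subset_Icc_right ht.2)

lemma continuousOn_primitive (u : LpSpace a b p) :
    ContinuousOn (fun t => ∫ s in a..t, u s) (Icc a b) := by
  rcases lt_or_ge b a with h | h
  · simp [Icc_eq_empty h.not_ge]
  · have := intervalIntegral.continuousOn_primitive_interval (f := u) (a := a) (b := b)
      (μ := volume) (by rw [uIcc_of_le h, integrableOn_Icc_iff_integrableOn_Ioo]; exact integrable_coe u)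
    rwa [uIcc_of_le h] at this

/-- Integration by parts against `φ`, that is, `integral_primitive_mul_add` with `h = φ'`. The
boundary terms vanish with `φ`. -/
lemma HasWeakDeriv.of_primitive (hab : a < b) (c : ℂ)
    (h : ∀ᵐ t ∂(intervalMeasure a b), u t = c + ∫ s in a..t, v s) : HasWeakDeriv 1 u v := by
  intro φ hφ
  have hg := intervalIntegrable_coe hab.le v
  have hcd : Continuous fun t => ((deriv φ t : ℝ) : ℂ) :=
    Complex.continuous_ofReal.comp hφ.deriv.smooth.continuous
  have hcφ : Continuous fun t => ((φ t : ℝ) : ℂ) :=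
    Complex.continuous_ofReal.comp hφ.smooth.continuous
  have hh : IntervalIntegrable (fun t => ((deriv φ t : ℝ) : ℂ)) volume a b :=
    hcd.intervalIntegrable _ _
  have key := integral_primitive_mul_add hab.le hg hh
  have hP : ContinuousOn (fun t => ∫ s in a..t, v s) (uIcc a b) := by
    rw [uIcc_of_le hab.le]; exact continuousOn_primitive v
  simp only [hφ.integral_deriv] at key
  rw [hφ.eq_zero_of_notMem (t := b) (by simp), Complex.ofReal_zero, mul_zero,
    intervalIntegral.integral_add (hh.continuousOn_mul hP)
      (hg.mul_continuousOn hcφ.continuousOn)] at key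
  have e1 : ∫ t in Ioo a b, iteratedDeriv 1 φ t • u t
      = ∫ t in Ioo a b, (c * ((deriv φ t : ℝ) : ℂ) + (∫ s in a..t, v s) * ((deriv φ t : ℝ) : ℂ)) := by
    refine integral_congr_ae ?_
    filter_upwards [h] with t ht
    rw [ht, iteratedDeriv_one, Complex.real_smul]
    ring
  have e2 : ∫ t in Ioo a b, φ t • v t = ∫ t in Ioo a b, v t * ((φ t : ℝ) : ℂ) := by
    simp only [Complex.real_smul, mul_comm]
  rw [e1, e2, setIntegral_Ioo_eq hab.le, setIntegral_Ioo_eq hab.le,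
    intervalIntegral.integral_add (hh.const_mul c) (hh.continuousOn_mul hP),
    intervalIntegral.integral_const_mul, hφ.integral_deriv,
    hφ.eq_zero_of_notMem (t := b) (by simp), eq_neg_of_add_eq_zero_left key]
  simp

/-- A function with zero weak derivative is constant. -/
lemma HasWeakDeriv.exists_const (hab : a < b) (h : HasWeakDeriv 1 u 0) :
    ∃ c : ℂ, ∀ᵐ t ∂(intervalMeasure a b), u t = c := by
  obtain ⟨ψ, hψ, hψ1⟩ := IsTestFunction.exists_integral_eq_one hab
  -- Since `ψ` has integral one, a constant `u` must equal this value. For general `φ`, the test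
  -- function `φ - (∫ φ) ψ` has zero mean, hence is a derivative and is annihilated by `u`.
  set c : ℂ := ∫ t in Ioo a b, ψ t • u t with hc
  have hz : ∀ η, IsTestFunction a b η → ∫ t in a..b, η t = 0 → ∫ t in Ioo a b, η t • u t = 0 := by
    intro η hη h0
    obtain ⟨φ, hφ, rfl⟩ := hη.exists_primitive hab h0
    have := h φ hφ
    rw [iteratedDeriv_one] at this
    rw [this, integral_eq_zero_of_ae, mul_zero]
    filter_upwards [Lp.coeFn_zero ℂ p (intervalMeasure a b)] with t ht
    rw [ht, Pi.zero_apply, smul_zero]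
  have key : ∀ᵐ t ∂(volume : Measure ℝ), t ∈ Ioo a b → u t - c = 0 := by
    refine isOpen_Ioo.ae_eq_zero_of_integral_contDiff_smul_eq_zero (f := fun t => u t - c) ?_ ?_
    · exact IntegrableOn.locallyIntegrableOn ((integrable_coe u).sub (integrable_const c))
    · intro φ h1 h2 h3
      have hφ : IsTestFunction a b φ := ⟨h1, h2, h3⟩
      have hcφ := hφ.smooth.continuous
      have hcψ := hψ.smooth.continuous
      have e0 : ∫ t, φ t • (u t - c) = ∫ t in Ioo a b, φ t • (u t - c) := by
        refine (setIntegral_eq_integral_of_forall_compl_eq_zero fun t ht => ?_).symm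
        rw [hφ.eq_zero_of_notMem ht, zero_smul]
      have hI := hz _ (hφ.sub_const_mul hψ (∫ t in a..b, φ t)) (by
        rw [intervalIntegral.integral_sub (hcφ.intervalIntegrable _ _)
          ((hcψ.intervalIntegrable _ _).const_mul _), intervalIntegral.integral_const_mul, hψ1]
        ring)
      have e1 : ∀ t, (φ t - (∫ t in a..b, φ t) * ψ t) • u t
          = φ t • u t - (∫ t in a..b, φ t) • (ψ t • u t) := fun t => by
        rw [sub_smul, mul_smul]
      simp only [e1] at hI
      have hψi : Integrable (fun t => (∫ t in a..b, φ t) • (ψ t • u t)) (intervalMeasure a b) :=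
        (integrable_smul hψ u).smul (∫ t in a..b, φ t)
      rw [integral_sub (integrable_smul hφ u) hψi, integral_smul,
        ← hc] at hI
      have hφc : Integrable (fun t => φ t • c) (intervalMeasure a b) :=
        ((hcφ.integrable_of_hasCompactSupport hφ.compact).smul_const c).integrableOn
      rw [e0]
      simp only [smul_sub]
      rw [integral_sub (integrable_smul hφ u) hφc, integral_smul_const,
        ← integral_Ioc_eq_integral_Ioo (f := φ), ← intervalIntegral.integral_of_le hab.le]
      exact hI
  refine ⟨c, ?_⟩
  rw [ae_restrict_iff' measurableSet_Ioo]
  filter_upwards [key] with t ht hm using sub_eq_zero.1 (ht hm)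

lemma memLp_of_continuousOn {f : ℝ → ℂ} (hf : ContinuousOn f (Icc a b)) :
    MemLp f p (intervalMeasure a b) := by
  obtain ⟨C, hC⟩ := isCompact_Icc.exists_bound_of_continuousOn hf
  refine MemLp.of_bound ((hf.mono Ioo_subset_Icc_self).aestronglyMeasurable measurableSet_Ioo) C ?_
  rw [ae_restrict_iff' measurableSet_Ioo]
  exact Eventually.of_forall fun t ht => hC t (Ioo_subset_Icc_self ht)

lemma HasWeakDeriv.sub {u' v' : LpSpace a b p} (h : HasWeakDeriv k u v)
    (h' : HasWeakDeriv k u' v') : HasWeakDeriv k (u - u') (v - v') := by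
  simpa [sub_eq_add_neg] using h.add (h'.smul (-1))

/-- Having a weak derivative of order one means being a primitive. -/
lemma hasWeakDeriv_one_iff (hab : a < b) : HasWeakDeriv 1 u v ↔
    ∃ c : ℂ, ∀ᵐ t ∂(intervalMeasure a b), u t = c + ∫ s in a..t, v s := by
  refine ⟨fun h => ?_, fun ⟨c, hc⟩ => .of_primitive hab c hc⟩
  have hm : MemLp (fun t => ∫ s in a..t, v s) p (intervalMeasure a b) :=
    memLp_of_continuousOn (continuousOn_primitive v)
  have h' : HasWeakDeriv 1 hm.toLp v := .of_primitive hab 0 (by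
    filter_upwards [hm.coeFn_toLp] with t ht
    rw [ht, zero_add])
  obtain ⟨c, hc⟩ := HasWeakDeriv.exists_const hab (by simpa using h.sub h')
  refine ⟨c, ?_⟩
  filter_upwards [hc, hm.coeFn_toLp, Lp.coeFn_sub u hm.toLp] with t h1 h2 h3
  rw [h3, Pi.sub_apply, h2] at h1
  rw [← h1]; ring

lemma HasWeakDeriv.comp (h : HasWeakDeriv k u v) (h' : HasWeakDeriv j v w) :
    HasWeakDeriv (k + j) u w := by
  intro φ hφ
  have e : iteratedDeriv (k + j) φ = iteratedDeriv k (iteratedDeriv j φ) := by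
    simp [iteratedDeriv_eq_iterate, Function.iterate_add]
  rw [e, h _ (hφ.iteratedDeriv j), h' φ hφ, pow_add, mul_assoc]

lemma HasWeakDeriv.of_comp (h : HasWeakDeriv k u v) (h' : HasWeakDeriv (k + j) u w) :
    HasWeakDeriv j v w := by
  intro φ hφ
  have e : iteratedDeriv (k + j) φ = iteratedDeriv k (iteratedDeriv j φ) := by
    simp [iteratedDeriv_eq_iterate, Function.iterate_add]
  have h1 := h _ (hφ.iteratedDeriv j)
  have h2 := h' φ hφ
  rw [e, h1, pow_add, mul_assoc] at h2
  exact mul_left_cancel₀ (pow_ne_zero _ (by norm_num)) h2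

end WeakCalculus

/-! ### Sup bounds, the product rule and closedness of the weak derivative. -/

section Bounds

variable {a b : ℝ} {p : ℝ≥0∞} [Fact (1 ≤ p)] {k : ℕ} {u u' v v' w w' : LpSpace a b p}

/-- Hölder's inequality on an interval of finite measure. -/
lemma exists_integral_norm_le (a b : ℝ) (p : ℝ≥0∞) [Fact (1 ≤ p)] :
    ∃ K : ℝ, 0 ≤ K ∧ ∀ u : LpSpace a b p, ∫ t in Ioo a b, ‖u t‖ ≤ K * ‖u‖ := by
  set c : ℝ≥0∞ := (intervalMeasure a b) univ ^ (1 / (1 : ℝ≥0∞).toReal - 1 / p.toReal) with hc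
  have hp : 1 ≤ p := Fact.out
  have hctop : c ≠ ⊤ := by
    refine ENNReal.rpow_ne_top_of_nonneg ?_ (measure_ne_top _ _)
    rw [ENNReal.toReal_one, div_one]
    -- At `p = ⊤` the convention `1 / 0 = 0` makes the exponent equal to `1`, as Hölder requires.
    rcases eq_or_ne p ⊤ with rfl | h
    · simp
    · have : 1 ≤ p.toReal := by
        simpa using ENNReal.toReal_mono h hp
      rw [sub_nonneg, div_le_one (by linarith)]
      exact this
  refine ⟨c.toReal, ENNReal.toReal_nonneg, fun u => ?_⟩
  have h1 := eLpNorm_le_eLpNorm_mul_rpow_measure_univ (μ := intervalMeasure a b) hp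
    (Lp.aestronglyMeasurable u)
  rw [← hc] at h1
  have h2 : ∫ t in Ioo a b, ‖u t‖ = (eLpNorm u 1 (intervalMeasure a b)).toReal := by
    rw [eLpNorm_one_eq_lintegral_enorm, integral_norm_eq_lintegral_enorm (Lp.aestronglyMeasurable u)]
  rw [h2, Lp.norm_def, mul_comm, ← ENNReal.toReal_mul]
  exact ENNReal.toReal_mono (ENNReal.mul_ne_top (Lp.eLpNorm_ne_top u) hctop) h1

lemma norm_primitive_le (u : LpSpace a b p) {t : ℝ} (ht : t ∈ Icc a b) :
    ‖∫ s in a..t, u s‖ ≤ ∫ s in Ioo a b, ‖u s‖ := by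
  have hI : IntegrableOn (fun s => ‖u s‖) (Ioc a b) := by
    rw [integrableOn_Ioc_iff_integrableOn_Ioo]; exact (integrable_coe u).norm
  rw [← integral_Ioc_eq_integral_Ioo]
  refine (intervalIntegral.norm_integral_le_integral_norm ht.1).trans ?_
  rw [intervalIntegral.integral_of_le ht.1]
  exact setIntegral_mono_set hI (Eventually.of_forall fun s => norm_nonneg _)
    (LE.le.eventuallyLE (Ioc_subset_Ioc_right ht.2))

lemma ae_mem_Ioo : ∀ᵐ t ∂(intervalMeasure a b), t ∈ Ioo a b := ae_restrict_mem measurableSet_Ioo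

/-- The embedding of `W^1_p` into `L_∞`. In `u = c + ∫ v` the primitive is at most `K * ‖v‖`, and
averaging `c = u - ∫ v` over the interval bounds the constant. -/
lemma exists_ae_norm_le (hab : a < b) (p : ℝ≥0∞) [Fact (1 ≤ p)] :
    ∃ K : ℝ, 0 ≤ K ∧ ∀ u v : LpSpace a b p, HasWeakDeriv 1 u v →
      ∀ᵐ t ∂(intervalMeasure a b), ‖u t‖ ≤ K * (‖u‖ + ‖v‖) := by
  obtain ⟨K, hK, hKb⟩ := exists_integral_norm_le a b p
  have hl : 0 < b - a := sub_pos.2 hab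
  refine ⟨K / (b - a) + 2 * K, by positivity, fun u v h => ?_⟩
  obtain ⟨c, hc⟩ := (hasWeakDeriv_one_iff hab).1 h
  have hV : ∀ t ∈ Ioo a b, ‖∫ s in a..t, v s‖ ≤ K * ‖v‖ := fun t ht =>
    (norm_primitive_le v (Ioo_subset_Icc_self ht)).trans (hKb v)
  have h1 : ∫ t in Ioo a b, ‖c‖ ≤ ∫ t in Ioo a b, (‖u t‖ + K * ‖v‖) := by
    refine integral_mono_ae (integrable_const _)
      ((integrable_coe u).norm.add (integrable_const _)) ?_
    filter_upwards [hc, ae_mem_Ioo] with t ht hm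
    have : c = u t - ∫ s in a..t, v s := by rw [ht]; ring
    rw [this]
    exact (norm_sub_le _ _).trans (by gcongr; exact hV t hm)
  rw [integral_add (integrable_coe u).norm (integrable_const _), setIntegral_const,
    setIntegral_const, Real.volume_real_Ioo_of_le hab.le, smul_eq_mul, smul_eq_mul] at h1
  have h2 : ‖c‖ ≤ K / (b - a) * ‖u‖ + K * ‖v‖ := by
    have h3 : (b - a) * ‖c‖ ≤ (b - a) * (K / (b - a) * ‖u‖ + K * ‖v‖) := by
      refine h1.trans ((add_le_add_left (hKb u) _).trans_eq ?_)
      field_simp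
    exact le_of_mul_le_mul_left h3 hl
  filter_upwards [hc, ae_mem_Ioo] with t ht hm
  rw [ht]
  refine (norm_add_le _ _).trans ((add_le_add h2 (hV t hm)).trans ?_)
  have h4 : 0 ≤ K / (b - a) * ‖v‖ := by positivity
  have h5 : 0 ≤ K * ‖u‖ := by positivity
  linarith

/-- The product of a function in `L_p` and an essentially bounded function. -/
lemma exists_Lp_mul (u v : LpSpace a b p) {C : ℝ} (hC : ∀ᵐ t ∂(intervalMeasure a b), ‖v t‖ ≤ C) :
    ∃ w : LpSpace a b p, (∀ᵐ t ∂(intervalMeasure a b), w t = u t * v t) ∧ ‖w‖ ≤ C * ‖u‖ := by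
  have hle : ∀ᵐ t ∂(intervalMeasure a b), ‖u t * v t‖ ≤ C * ‖u t‖ := by
    filter_upwards [hC] with t ht
    rw [norm_mul, mul_comm]
    gcongr
  have hm : MemLp (fun t => u t * v t) p (intervalMeasure a b) :=
    (Lp.memLp u).of_le_mul ((Lp.aestronglyMeasurable u).mul (Lp.aestronglyMeasurable v)) hle
  refine ⟨hm.toLp, hm.coeFn_toLp, Lp.norm_le_mul_norm_of_ae_le_mul ?_⟩
  filter_upwards [hm.coeFn_toLp, hle] with t h1 h2
  rw [h1]; exact h2

lemma ae_restrict_Ioc_of_ae {P : ℝ → Prop} (h : ∀ᵐ t ∂(intervalMeasure a b), P t) {t : ℝ}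
    (ht : t ∈ Icc a b) : ∀ᵐ s ∂volume, s ∈ uIoc a t → P s := by
  have h' : ∀ᵐ s ∂(volume.restrict (Ioc a b)), P s := by
    rwa [intervalMeasure, restrict_Ioo_eq_restrict_Ioc] at h
  rw [ae_restrict_iff' measurableSet_Ioc] at h'
  filter_upwards [h'] with s hs hst
  rw [uIoc_of_le ht.1] at hst
  exact hs (Ioc_subset_Ioc_right ht.2 hst)

/-- The product rule for weak derivatives. -/
lemma HasWeakDeriv.mul (hab : a < b) (hu : HasWeakDeriv 1 u u') (hv : HasWeakDeriv 1 v v')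
    (hw : ∀ᵐ t ∂(intervalMeasure a b), w t = u t * v t)
    (hw' : ∀ᵐ t ∂(intervalMeasure a b), w' t = u' t * v t + u t * v' t) :
    HasWeakDeriv 1 w w' := by
  obtain ⟨c, hc⟩ := (hasWeakDeriv_one_iff hab).1 hu
  obtain ⟨d, hd⟩ := (hasWeakDeriv_one_iff hab).1 hv
  refine .of_primitive hab (c * d) ?_
  filter_upwards [hw, hc, hd, ae_mem_Ioo] with t h1 h2 h3 hm
  have ht := Ioo_subset_Icc_self hm
  have hiu := intervalIntegrable_coe_of_mem u' ht
  have hiv := intervalIntegrable_coe_of_mem v' ht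
  have hsub : uIcc a t ⊆ Icc a b := by rw [uIcc_of_le ht.1]; exact Icc_subset_Icc_right ht.2
  have hU := (continuousOn_primitive u').mono hsub
  have hV := (continuousOn_primitive v').mono hsub
  -- With `u = c + U` and `v = d + V`, the derivative splits into `d u' + c v'` and `U v' + u' V`.
  -- The second part integrates to `U V` by `integral_primitive_mul_add`.
  have e : ∫ s in a..t, w' s = ∫ s in a..t, ((d * u' s + c * v' s) +
      ((∫ x in a..s, u' x) * v' s + u' s * ∫ x in a..s, v' x)) := by
    refine intervalIntegral.integral_congr_ae ?_
    filter_upwards [ae_restrict_Ioc_of_ae hw' ht, ae_restrict_Ioc_of_ae hc ht,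
      ae_restrict_Ioc_of_ae hd ht] with s h4 h5 h6 hs
    rw [h4 hs, h5 hs, h6 hs]
    ring
  rw [e, intervalIntegral.integral_add ((hiu.const_mul d).add (hiv.const_mul c))
      ((hiv.continuousOn_mul hU).add (hiu.mul_continuousOn hV)),
    intervalIntegral.integral_add (hiu.const_mul d) (hiv.const_mul c),
    intervalIntegral.integral_const_mul, intervalIntegral.integral_const_mul,
    integral_primitive_mul_add ht.1 hiu hiv, h1, h2, h3]
  ring

lemma tendsto_integral_test {φ : ℝ → ℝ} (hφ : IsTestFunction a b φ) {ι : Type*} {l : Filter ι}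
    {u : ι → LpSpace a b p} {u₀ : LpSpace a b p} (h : Tendsto u l (𝓝 u₀)) :
    Tendsto (fun i => ∫ t in Ioo a b, φ t • u i t) l (𝓝 (∫ t in Ioo a b, φ t • u₀ t)) := by
  obtain ⟨K, hK, hKb⟩ := exists_integral_norm_le a b p
  obtain ⟨C, hC⟩ := hφ.compact.exists_bound_of_continuous hφ.smooth.continuous
  rw [tendsto_iff_norm_sub_tendsto_zero] at h ⊢
  have hle : ∀ i, ‖(∫ t in Ioo a b, φ t • u i t) - ∫ t in Ioo a b, φ t • u₀ t‖
      ≤ C * (K * ‖u i - u₀‖) := by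
    intro i
    rw [← integral_sub (integrable_smul hφ _) (integrable_smul hφ _)]
    have e : ∫ t in Ioo a b, (φ t • u i t - φ t • u₀ t)
        = ∫ t in Ioo a b, φ t • (u i - u₀) t := by
      refine integral_congr_ae ?_
      filter_upwards [Lp.coeFn_sub (u i) u₀] with t ht
      rw [ht, Pi.sub_apply, smul_sub]
    rw [e]
    have hC0 : 0 ≤ C := (norm_nonneg _).trans (hC 0)
    calc ‖∫ t in Ioo a b, φ t • (u i - u₀) t‖
        ≤ ∫ t in Ioo a b, ‖φ t • (u i - u₀) t‖ := norm_integral_le_integral_norm _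
      _ ≤ ∫ t in Ioo a b, C * ‖(u i - u₀) t‖ := by
          refine integral_mono (integrable_smul hφ _).norm
            ((integrable_coe (u i - u₀)).norm.const_mul C) fun t => ?_
          simp only [norm_smul]
          exact mul_le_mul_of_nonneg_right (hC t) (norm_nonneg _)
      _ ≤ _ := by
          rw [integral_const_mul]
          exact mul_le_mul_of_nonneg_left (hKb _) hC0
  refine squeeze_zero (fun i => norm_nonneg _) hle ?_
  simpa using (h.const_mul K).const_mul C

/-- The weak derivative is a closed operator: both sides of its defining identity are continuous in
`L_p`. Completeness of `W^n_p` rests on this. -/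
lemma HasWeakDeriv.of_tendsto {ι : Type*} {l : Filter ι} [l.NeBot] {f g : ι → LpSpace a b p}
    (h : ∀ i, HasWeakDeriv k (f i) (g i)) (hf : Tendsto f l (𝓝 u)) (hg : Tendsto g l (𝓝 v)) :
    HasWeakDeriv k u v := by
  intro φ hφ
  refine tendsto_nhds_unique (tendsto_integral_test (hφ.iteratedDeriv k) hf) ?_
  simp only [fun i => h i φ hφ]
  exact (tendsto_integral_test hφ hg).const_mul _

end Bounds

/-! ### Completeness, derivatives as operators, and products in Sobolev spaces. -/

namespace SobolevSpace

variable {a b : ℝ} {p : ℝ≥0∞} [Fact (1 ≤ p)] {n N l j k : ℕ}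

/-- An element of `L_p` all of whose weak derivatives of orders `≤ n` exist, as an element
of `W^n_p`. -/
def ofMem (u : LpSpace a b p) (h : ∀ k ≤ n, ∃ v, HasWeakDeriv k u v) : SobolevSpace a b p n :=
  (⟨u, h⟩ : ↥(sobolevSubmodule a b p n))

@[simp] lemma toLp_ofMem (u : LpSpace a b p) (h : ∀ k ≤ n, ∃ v, HasWeakDeriv k u v) :
    toLp (ofMem u h) = u := rfl

lemma deriv_eq (hk : k ≤ n) {u : SobolevSpace a b p n} {v : LpSpace a b p}
    (h : HasWeakDeriv k (toLp u) v) : u.deriv k = v :=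
  (hasWeakDeriv_deriv hk u).unique h

lemma hasWeakDeriv_deriv_deriv (h : j + k ≤ n) (u : SobolevSpace a b p n) :
    HasWeakDeriv k (u.deriv j) (u.deriv (j + k)) :=
  (hasWeakDeriv_deriv (by omega) u).of_comp (hasWeakDeriv_deriv h u)

lemma norm_deriv_le (hk : k ≤ n) (u : SobolevSpace a b p n) : ‖u.deriv k‖ ≤ ‖u‖ :=
  Finset.single_le_sum (f := fun k => ‖u.deriv k‖) (fun _ _ => norm_nonneg _)
    (Finset.mem_range.2 (Nat.lt_succ_of_le hk))

lemma deriv_sub (hk : k ≤ n) (u v : SobolevSpace a b p n) :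
    deriv k (u - v) = deriv k u - deriv k v := by
  rw [sub_eq_add_neg, deriv_add hk, ← neg_one_smul ℂ v, deriv_smul hk, neg_one_smul, sub_eq_add_neg]

/-- Each derivative of a Cauchy sequence converges in `L_p`, and closedness identifies the limits as
derivatives of one function. Completeness is needed for the Banach inverse and Banach–Steinhaus
theorems. -/
instance : CompleteSpace (SobolevSpace a b p n) := by
  refine Metric.complete_of_cauchySeq_tendsto fun u hu => ?_
  have hd : ∀ k ≤ n, ∃ v, Tendsto (fun i => (u i).deriv k) atTop (𝓝 v) := by
    intro k hk
    refine cauchySeq_tendsto_of_complete ?_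
    rw [Metric.cauchySeq_iff] at hu ⊢
    intro ε hε
    obtain ⟨M, hM⟩ := hu ε hε
    refine ⟨M, fun i hi i' hi' => ?_⟩
    rw [dist_eq_norm, ← deriv_sub hk]
    exact (norm_deriv_le hk _).trans_lt (by rw [← dist_eq_norm]; exact hM i hi i' hi')
  choose! v hv using hd
  have h0 : Tendsto (fun i => toLp (u i)) atTop (𝓝 (v 0)) := by
    simpa only [deriv_zero_eq] using hv 0 (Nat.zero_le n)
  have hw : ∀ k ≤ n, HasWeakDeriv k (v 0) (v k) := fun k hk =>
    .of_tendsto (fun i => hasWeakDeriv_deriv hk (u i)) h0 (hv k hk)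
  refine ⟨ofMem (v 0) fun k hk => ⟨v k, hw k hk⟩, ?_⟩
  rw [tendsto_iff_norm_sub_tendsto_zero]
  simp only [norm_def]
  have hz : ∑ k ∈ Finset.range (n + 1), (0 : ℝ) = 0 := Finset.sum_const_zero
  refine hz ▸ tendsto_finsetSum _ fun k hk => ?_
  have hk' := Nat.lt_succ_iff.1 (Finset.mem_range.1 hk)
  have e : ∀ i, deriv k (u i - ofMem (v 0) fun k hk => ⟨v k, hw k hk⟩) = (u i).deriv k - v k := by
    intro i
    rw [deriv_sub hk', deriv_eq (u := ofMem (v 0) fun k hk => ⟨v k, hw k hk⟩) hk' (hw k hk')]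
  simp only [e]
  exact tendsto_iff_norm_sub_tendsto_zero.1 (hv k hk')

/-- The `j`-th derivative as an operator `W^N_p → W^l_p` for `j + l ≤ N`. -/
def derivCLM (h : j + l ≤ N) : SobolevSpace a b p N →L[ℂ] SobolevSpace a b p l :=
  LinearMap.mkContinuous
    { toFun := fun u => ofMem (u.deriv j) fun k hk =>
        ⟨u.deriv (j + k), hasWeakDeriv_deriv_deriv (by omega) u⟩
      map_add' := fun u v => toLp_injective (deriv_add (by omega) u v)
      map_smul' := fun z u => toLp_injective (deriv_smul (by omega) z u) } 1 (by
    intro u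
    rw [one_mul, norm_def, norm_def]
    have e : ∀ i ∈ Finset.range (l + 1), ‖deriv i (ofMem (n := l) (u.deriv j) fun k hk =>
        ⟨u.deriv (j + k), hasWeakDeriv_deriv_deriv (by omega) u⟩)‖ = ‖u.deriv (j + i)‖ := by
      intro i hi
      have hi' := Nat.lt_succ_iff.1 (Finset.mem_range.1 hi)
      rw [deriv_eq hi' (v := u.deriv (j + i)) (hasWeakDeriv_deriv_deriv (by omega) u)]
    refine (Finset.sum_congr rfl e).trans_le ?_
    have := Finset.sum_Ico_eq_sum_range (fun k => ‖u.deriv k‖) j (j + l + 1)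
    rw [show j + l + 1 - j = l + 1 by omega] at this
    rw [← this]
    refine Finset.sum_le_sum_of_subset_of_nonneg ?_ fun _ _ _ => norm_nonneg _
    intro k hk
    rw [Finset.mem_Ico] at hk
    exact Finset.mem_range.2 (by omega))

@[simp] lemma toLp_derivCLM (h : j + l ≤ N) (u : SobolevSpace a b p N) :
    toLp (derivCLM h u) = u.deriv j := rfl

lemma norm_derivCLM_le (h : j + l ≤ N) (u : SobolevSpace a b p N) : ‖derivCLM h u‖ ≤ ‖u‖ := by
  simpa using (LinearMap.mkContinuous_norm_le _ zero_le_one _ :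
    ‖(derivCLM h : SobolevSpace a b p N →L[ℂ] SobolevSpace a b p l)‖ ≤ 1) |>
      fun h' => (derivCLM h).le_of_opNorm_le h' u

/-- A primitive of an element of `W^n_p` is in `W^{n+1}_p`. -/
lemma exists_of_hasWeakDeriv {u : LpSpace a b p} {v : SobolevSpace a b p n}
    (h : HasWeakDeriv 1 u (toLp v)) :
    ∃ w : SobolevSpace a b p (n + 1), toLp w = u ∧ ‖w‖ = ‖u‖ + ‖v‖ := by
  have hk : ∀ k ≤ n, HasWeakDeriv (k + 1) u (v.deriv k) := fun k hk => by
    rw [add_comm]; exact h.comp (hasWeakDeriv_deriv hk v)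
  have hm : ∀ k ≤ n + 1, ∃ w, HasWeakDeriv k u w := by
    rintro (_ | k) hk'
    · exact ⟨u, hasWeakDeriv_self u⟩
    · exact ⟨_, hk k (by omega)⟩
  refine ⟨ofMem u hm, rfl, ?_⟩
  rw [norm_def, Finset.sum_range_succ', deriv_zero_eq, toLp_ofMem, add_comm, norm_def]
  congr 1
  refine Finset.sum_congr rfl fun k hk' => ?_
  have := Nat.lt_succ_iff.1 (Finset.mem_range.1 hk')
  rw [deriv_eq (v := v.deriv k) (by omega) (hk k this)]

lemma coeFn_add (u v : SobolevSpace a b p n) :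
    ∀ᵐ t ∂(intervalMeasure a b), toLp (u + v) t = toLp u t + toLp v t := by
  rw [map_add]
  filter_upwards [Lp.coeFn_add (toLp u) (toLp v)] with t ht
  rw [ht, Pi.add_apply]

lemma exists_ae_norm_le (hab : a < b) (p : ℝ≥0∞) [Fact (1 ≤ p)] (n : ℕ) :
    ∃ K : ℝ, 0 ≤ K ∧ ∀ u : SobolevSpace a b p (n + 1),
      ∀ᵐ t ∂(intervalMeasure a b), ‖toLp u t‖ ≤ K * ‖u‖ := by
  obtain ⟨K, hK, h⟩ := SobolevBVP.exists_ae_norm_le hab p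
  refine ⟨K, hK, fun u => ?_⟩
  filter_upwards [h _ _ (hasWeakDeriv_deriv (k := 1) (by omega) u)] with t ht
  refine ht.trans (mul_le_mul_of_nonneg_left ?_ hK)
  rw [← deriv_zero_eq, norm_def, Finset.sum_range_succ', Finset.sum_range_succ',
    add_comm ‖deriv 0 u‖, add_assoc]
  exact le_add_of_nonneg_left (Finset.sum_nonneg fun _ _ => norm_nonneg _)

/-- If multiplication is bounded from `W^n_p × W^{n+1}_p` to `W^n_p`, then `W^{n+1}_p` is an
algebra. -/
lemma exists_mul_succ (hab : a < b) (h : ∃ C : ℝ, 0 ≤ C ∧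
      ∀ (u : SobolevSpace a b p n) (v : SobolevSpace a b p (n + 1)), ∃ w : SobolevSpace a b p n,
        (∀ᵐ t ∂(intervalMeasure a b), toLp w t = toLp u t * toLp v t) ∧ ‖w‖ ≤ C * ‖u‖ * ‖v‖) :
    ∃ C : ℝ, 0 ≤ C ∧
      ∀ u v : SobolevSpace a b p (n + 1), ∃ w : SobolevSpace a b p (n + 1),
        (∀ᵐ t ∂(intervalMeasure a b), toLp w t = toLp u t * toLp v t) ∧ ‖w‖ ≤ C * ‖u‖ * ‖v‖ := by
  obtain ⟨C, hC, hmul⟩ := h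
  obtain ⟨K, hK, hsup⟩ := exists_ae_norm_le hab p n
  refine ⟨K + 2 * C, by positivity, fun u v => ?_⟩
  have hd : 1 + n ≤ n + 1 := by omega
  obtain ⟨w₀, hw₀, hn₀⟩ := exists_Lp_mul (toLp u) (toLp v) (hsup v)
  obtain ⟨w₁, hw₁, hn₁⟩ := hmul (derivCLM hd u) v
  obtain ⟨w₂, hw₂, hn₂⟩ := hmul (derivCLM hd v) u
  -- In `(uv)' = u'v + v'u` each product again pairs `W^n_p` with `W^{n+1}_p`, which is exactly what
  -- `hmul` covers.
  have hw : HasWeakDeriv 1 w₀ (toLp (w₁ + w₂)) := by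
    refine HasWeakDeriv.mul hab (hasWeakDeriv_deriv (k := 1) (by omega) u)
      (hasWeakDeriv_deriv (k := 1) (by omega) v) hw₀ ?_
    filter_upwards [hw₁, hw₂, coeFn_add w₁ w₂] with t h1 h2 h3
    rw [h3, h1, h2, toLp_derivCLM, toLp_derivCLM]
    ring
  obtain ⟨w, hwe, hwn⟩ := exists_of_hasWeakDeriv hw
  refine ⟨w, by rw [hwe]; exact hw₀, ?_⟩
  have h0 : ‖toLp u‖ ≤ ‖u‖ := by rw [← deriv_zero_eq]; exact norm_deriv_le (by omega) u
  calc ‖w‖ ≤ ‖w₀‖ + (‖w₁‖ + ‖w₂‖) := by rw [hwn]; gcongr; exact norm_add_le _ _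
    _ ≤ K * ‖v‖ * ‖u‖ + (C * ‖u‖ * ‖v‖ + C * ‖v‖ * ‖u‖) := by
        gcongr
        · exact hn₀.trans (by gcongr)
        · exact hn₁.trans (by gcongr; exact norm_derivCLM_le hd u)
        · exact hn₂.trans (by gcongr; exact norm_derivCLM_le hd v)
    _ = (K + 2 * C) * ‖u‖ * ‖v‖ := by ring

/-- Multiplication is bounded from `W^n_p × W^{n+1}_p` to `W^n_p`. -/
lemma exists_mul (hab : a < b) (p : ℝ≥0∞) [Fact (1 ≤ p)] (n : ℕ) : ∃ C : ℝ, 0 ≤ C ∧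
    ∀ (u : SobolevSpace a b p n) (v : SobolevSpace a b p (n + 1)), ∃ w : SobolevSpace a b p n,
      (∀ᵐ t ∂(intervalMeasure a b), toLp w t = toLp u t * toLp v t) ∧ ‖w‖ ≤ C * ‖u‖ * ‖v‖ := by
  induction n with
  | zero =>
    obtain ⟨K, hK, hsup⟩ := exists_ae_norm_le hab p 0
    refine ⟨K, hK, fun u v => ?_⟩
    obtain ⟨w, hw, hn⟩ := exists_Lp_mul (toLp u) (toLp v) (hsup v)
    have hm : ∀ k ≤ 0, ∃ w', HasWeakDeriv k w w' := by
      intro k hk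
      obtain rfl : k = 0 := by omega
      exact ⟨w, hasWeakDeriv_self w⟩
    have e : ∀ x : SobolevSpace a b p 0, ‖x‖ = ‖toLp x‖ := fun x => by
      rw [norm_def, Finset.sum_range_one, deriv_zero_eq]
    refine ⟨ofMem w hm, hw, ?_⟩
    rw [e, e u, toLp_ofMem]
    exact hn.trans_eq (by ring)
  | succ n ih =>
    obtain ⟨C, hC, h⟩ := exists_mul_succ hab ih
    -- `derivCLM` of order `0` is the inclusion of `W^{n+2}_p` into the algebra `W^{n+1}_p`.
    have hd : 0 + (n + 1) ≤ n + 1 + 1 := by omega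
    refine ⟨C, hC, fun u v => ?_⟩
    obtain ⟨w, hw, hn⟩ := h u (derivCLM hd v)
    refine ⟨w, ?_, hn.trans (by gcongr; exact norm_derivCLM_le hd v)⟩
    rw [toLp_derivCLM, deriv_zero_eq] at hw
    exact hw

end SobolevSpace

/-! ### Multiplication as a bounded bilinear map. -/

namespace SobolevSpace

variable {a b : ℝ} {p : ℝ≥0∞} [Fact (1 ≤ p)] {n : ℕ}

lemma ext_ae {u v : SobolevSpace a b p n}
    (h : ∀ᵐ t ∂(intervalMeasure a b), toLp u t = toLp v t) : u = v :=
  toLp_injective (Lp.ext h)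

lemma coeFn_smul (z : ℂ) (u : SobolevSpace a b p n) :
    ∀ᵐ t ∂(intervalMeasure a b), toLp (z • u) t = z * toLp u t := by
  rw [map_smul]
  filter_upwards [Lp.coeFn_smul z (toLp u)] with t ht
  rw [ht, Pi.smul_apply, smul_eq_mul]

lemma coeFn_sum {ι : Type*} (s : Finset ι) (u : ι → SobolevSpace a b p n) :
    ∀ᵐ t ∂(intervalMeasure a b), toLp (∑ i ∈ s, u i) t = ∑ i ∈ s, toLp (u i) t := by
  classical
  induction s using Finset.induction_on with
  | empty =>
    rw [Finset.sum_empty, map_zero]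
    filter_upwards [Lp.coeFn_zero ℂ p (intervalMeasure a b)] with t ht
    rw [ht, Finset.sum_empty, Pi.zero_apply]
  | insert i s hi ih =>
    rw [Finset.sum_insert hi]
    filter_upwards [ih, coeFn_add (u i) (∑ i ∈ s, u i)] with t h1 h2
    rw [h2, h1, Finset.sum_insert hi]

/-- The pointwise product of elements of `W^n_p` and `W^{n+1}_p`. -/
def mul (hab : a < b) (u : SobolevSpace a b p n) (v : SobolevSpace a b p (n + 1)) :
    SobolevSpace a b p n :=
  ((exists_mul hab p n).choose_spec.2 u v).choose

lemma coeFn_mul (hab : a < b) (u : SobolevSpace a b p n) (v : SobolevSpace a b p (n + 1)) :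
    ∀ᵐ t ∂(intervalMeasure a b), toLp (mul hab u v) t = toLp u t * toLp v t :=
  ((exists_mul hab p n).choose_spec.2 u v).choose_spec.1

/-- Multiplication as a bounded bilinear map `W^n_p × W^{n+1}_p → W^n_p`. -/
def mulCLM (hab : a < b) :
    SobolevSpace a b p n →L[ℂ] SobolevSpace a b p (n + 1) →L[ℂ] SobolevSpace a b p n :=
  LinearMap.mkContinuous₂
    (LinearMap.mk₂ ℂ (mul hab)
      (fun u u' v => ext_ae (by
        filter_upwards [coeFn_mul hab (u + u') v, coeFn_mul hab u v, coeFn_mul hab u' v,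
          coeFn_add u u', coeFn_add (mul hab u v) (mul hab u' v)] with t h1 h2 h3 h4 h5
        rw [h1, h5, h2, h3, h4, add_mul]))
      (fun z u v => ext_ae (by
        filter_upwards [coeFn_mul hab (z • u) v, coeFn_mul hab u v, coeFn_smul z u,
          coeFn_smul z (mul hab u v)] with t h1 h2 h3 h4
        rw [h1, h4, h2, h3, mul_assoc]))
      (fun u v v' => ext_ae (by
        filter_upwards [coeFn_mul hab u (v + v'), coeFn_mul hab u v, coeFn_mul hab u v',
          coeFn_add v v', coeFn_add (mul hab u v) (mul hab u v')] with t h1 h2 h3 h4 h5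
        rw [h1, h5, h2, h3, h4, mul_add]))
      (fun z u v => ext_ae (by
        filter_upwards [coeFn_mul hab u (z • v), coeFn_mul hab u v, coeFn_smul z v,
          coeFn_smul z (mul hab u v)] with t h1 h2 h3 h4
        rw [h1, h4, h2, h3, mul_left_comm])))
    (exists_mul hab p n).choose
    fun u v => ((exists_mul hab p n).choose_spec.2 u v).choose_spec.2

lemma coeFn_mulCLM (hab : a < b) (u : SobolevSpace a b p n) (v : SobolevSpace a b p (n + 1)) :
    ∀ᵐ t ∂(intervalMeasure a b), toLp (mulCLM hab u v) t = toLp u t * toLp v t :=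
  coeFn_mul hab u v

end SobolevSpace

open SobolevSpace

/-! ### The differential expression as a bounded operator. -/

section DiffOp

variable {a b : ℝ} {p : ℝ≥0∞} [Fact (1 ≤ p)] {n m r : ℕ}

/-- The differential expression as a bounded operator `(W^{n+r}_p)^m → (W^n_p)^m`. -/
def diffOp (hab : a < b) (A : Fin r → MatSobolev a b p n m) :
    VecSobolev a b p (n + r) m →L[ℂ] VecSobolev a b p n m :=
  ContinuousLinearMap.pi fun i =>
    (derivCLM (j := r) (by omega)) ∘L ContinuousLinearMap.proj i +
      -- As `j < r`, the `j`-th derivative of an element of `W^{n+r}_p` still lies in `W^{n+1}_p`,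
      -- the space that `mulCLM` accepts.
      ∑ j : Fin r, ∑ k : Fin m, (mulCLM hab (A j i k)) ∘L
        (derivCLM (j := (j : ℕ)) (by omega)) ∘L ContinuousLinearMap.proj k

lemma diffOp_apply (hab : a < b) (A : Fin r → MatSobolev a b p n m)
    (y : VecSobolev a b p (n + r) m) (i : Fin m) :
    diffOp hab A y i = derivCLM (j := r) (l := n) (by omega) (y i) +
      ∑ j : Fin r, ∑ k : Fin m, mulCLM hab (A j i k)
        (derivCLM (j := (j : ℕ)) (by omega) (y k)) := by
  simp [diffOp]

lemma coeFn_diffOp (hab : a < b) (A : Fin r → MatSobolev a b p n m)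
    (y : VecSobolev a b p (n + r) m) (i : Fin m) :
    ∀ᵐ t ∂(intervalMeasure a b), toLp (diffOp hab A y i) t = diffExpr A y t i := by
  rw [diffOp_apply]
  have h1 := coeFn_add (derivCLM (j := r) (l := n) (by omega) (y i))
    (∑ j : Fin r, ∑ k : Fin m, mulCLM hab (A j i k) (derivCLM (j := (j : ℕ)) (by omega) (y k)))
  have h2 := coeFn_sum Finset.univ fun j : Fin r => ∑ k : Fin m, mulCLM hab (A j i k)
    (derivCLM (j := (j : ℕ)) (by omega) (y k))
  have h3 := ae_all_iff.2 fun j : Fin r => coeFn_sum Finset.univ fun k : Fin m =>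
    mulCLM hab (A j i k) (derivCLM (j := (j : ℕ)) (by omega) (y k))
  have h4 := ae_all_iff.2 fun j : Fin r => ae_all_iff.2 fun k : Fin m =>
    coeFn_mulCLM hab (A j i k) (derivCLM (j := (j : ℕ)) (by omega) (y k))
  filter_upwards [h1, h2, h3, h4] with t h1 h2 h3 h4
  rw [h1, h2, toLp_derivCLM]
  simp only [h3, h4, toLp_derivCLM]
  simp [diffExpr, vecDeriv, matValue, Matrix.mulVec, dotProduct]

lemma diffOp_eq_iff (hab : a < b) (A : Fin r → MatSobolev a b p n m)
    (y : VecSobolev a b p (n + r) m) (f : VecSobolev a b p n m) :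
    diffOp hab A y = f ↔ ∀ᵐ t ∂(intervalMeasure a b), diffExpr A y t = vecDeriv 0 f t := by
  have h0 := ae_all_iff.2 fun i => coeFn_diffOp hab A y i
  constructor
  · rintro rfl
    filter_upwards [h0] with t ht
    funext i
    rw [← ht i, vecDeriv, deriv_zero_eq]
  · intro h
    funext i
    refine ext_ae ?_
    filter_upwards [h0, h] with t h1 h2
    rw [h1 i, h2, vecDeriv, deriv_zero_eq]

lemma isSolution_iff (hab : a < b) {A : Fin r → MatSobolev a b p n m}
    {B : VecSobolev a b p (n + r) m →L[ℂ] (Fin (r * m) → ℂ)}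
    {f : VecSobolev a b p n m} {c : Fin (r * m) → ℂ} {y : VecSobolev a b p (n + r) m} :
    IsSolution A B f c y ↔ diffOp hab A y = f ∧ B y = c := by
  rw [IsSolution, diffOp_eq_iff]

lemma tendsto_matSobolev_iff {ι : Type*} {l : Filter ι} {A : ι → MatSobolev a b p n m}
    {A₀ : MatSobolev a b p n m} :
    Tendsto A l (𝓝 A₀) ↔ ∀ i k, Tendsto (fun ε => A ε i k) l (𝓝 (A₀ i k)) :=
  tendsto_pi_nhds.trans (forall_congr' fun _ => tendsto_pi_nhds)

/-- Written as a finite sum of compositions, the operator depends on `A` only through the continuous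
linear map `mulCLM`, and composition is continuous in the operator norm. -/
lemma continuous_diffOp (hab : a < b) :
    Continuous (diffOp hab : (Fin r → MatSobolev a b p n m) → _) := by
  have e : ∀ A : Fin r → MatSobolev a b p n m, diffOp hab A =
      ∑ i, (ContinuousLinearMap.single ℂ (fun _ : Fin m => SobolevSpace a b p n) i) ∘L
        ((derivCLM (j := r) (by omega)) ∘L ContinuousLinearMap.proj i +
          ∑ j : Fin r, ∑ k : Fin m, (mulCLM hab (A j i k)) ∘L
            (derivCLM (j := (j : ℕ)) (by omega)) ∘L ContinuousLinearMap.proj k) := by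
    intro A
    refine ContinuousLinearMap.ext fun y => funext fun i => ?_
    simp only [diffOp_apply, _root_.sum_apply, ContinuousLinearMap.comp_apply,
      _root_.add_apply, ContinuousLinearMap.proj_apply,
      ContinuousLinearMap.single_apply, Finset.sum_apply]
    rw [Fintype.sum_eq_single i fun k hk => Pi.single_eq_of_ne hk.symm _, Pi.single_eq_same]
  rw [funext e]
  refine continuous_finsetSum _ fun i _ => continuous_const.clm_comp (continuous_const.add
    (continuous_finsetSum _ fun j _ => continuous_finsetSum _ fun k _ => ?_))
  exact ((mulCLM hab).continuous.comp
    ((continuous_apply j).matrix_elem i k)).clm_comp continuous_const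

lemma tendsto_diffOp (hab : a < b) {ι : Type*} {l : Filter ι}
    {A : ι → Fin r → MatSobolev a b p n m} {A₀ : Fin r → MatSobolev a b p n m}
    (h : ∀ j, Tendsto (fun ε => A ε j) l (𝓝 (A₀ j))) :
    Tendsto (fun ε => diffOp hab (A ε)) l (𝓝 (diffOp hab A₀)) :=
  ((continuous_diffOp hab).tendsto A₀).comp (tendsto_pi_nhds.2 h)

end DiffOp

/-! ### The Cauchy problem for linear systems, by contraction in a weighted metric. -/

section LinearSystem

variable {a b : ℝ}

lemma intervalIntegrable_sum {G : Type*} [NormedAddCommGroup G] {ι : Type*} (s : Finset ι)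
    {f : ι → ℝ → G} (h : ∀ i ∈ s, IntervalIntegrable (f i) volume a b) :
    IntervalIntegrable (fun t => ∑ i ∈ s, f i t) volume a b := by
  have e : (fun t => ∑ i ∈ s, f i t) = ∑ i ∈ s, f i := by
    funext t
    rw [Finset.sum_apply]
  rw [e]
  exact IntervalIntegrable.sum s h

/-- Split `α` into a bounded continuous `g` and an error of `L_1` norm at most `1/4`. The part of
`g` contributes at most `‖g‖ / l ≤ 1/4` for `l = 4‖g‖ + 1`. This gives a contraction on the whole
interval although `α` is merely integrable. -/
lemma exists_weight_integral_le (hab : a < b) {α : ℝ → ℝ} (hα : IntervalIntegrable α volume a b) :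
    ∃ l : ℝ, ∀ t ∈ Icc a b, ∫ s in a..t, α s * Real.exp (-l * (t - s)) ≤ 1 / 2 := by
  have hα' : Integrable α (volume.restrict (Ioc a b)) :=
    (intervalIntegrable_iff_integrableOn_Ioc_of_le hab.le).1 hα
  obtain ⟨g, hg, hgi⟩ := hα'.exists_boundedContinuous_integral_sub_le (ε := 1 / 4) (by norm_num)
  set l : ℝ := 4 * ‖g‖ + 1 with hl
  have hlpos : 0 < l := by positivity
  refine ⟨l, fun t ht => ?_⟩
  have hsub : IntervalIntegrable (fun s => ‖α s - g s‖) volume a t := by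
    refine IntervalIntegrable.mono_set (a := a) (b := b) ?_ (by
      rw [uIcc_of_le ht.1, uIcc_of_le hab.le]; exact Icc_subset_Icc_right ht.2)
    exact ((intervalIntegrable_iff_integrableOn_Ioc_of_le hab.le).2 (hα'.sub hgi)).norm
  have hexp : Continuous fun s => Real.exp (-l * (t - s)) := by fun_prop
  have hpr : IntervalIntegrable (fun s => α s * Real.exp (-l * (t - s))) volume a t :=
    (hα.mono_set (by
      rw [uIcc_of_le ht.1, uIcc_of_le hab.le]; exact Icc_subset_Icc_right ht.2)).mul_continuousOn
        hexp.continuousOn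
  have h1 : ∫ s in a..t, α s * Real.exp (-l * (t - s))
      ≤ ∫ s in a..t, (‖α s - g s‖ + ‖g‖ * Real.exp (-l * (t - s))) := by
    refine intervalIntegral.integral_mono_on ht.1 hpr
      (hsub.add ((hexp.intervalIntegrable _ _).const_mul _)) fun s hs => ?_
    have he1 : Real.exp (-l * (t - s)) ≤ 1 := by
      rw [Real.exp_le_one_iff]
      nlinarith [hs.2]
    have he0 := Real.exp_nonneg (-l * (t - s))
    have h2 : g s ≤ ‖g‖ := (le_abs_self _).trans (g.norm_coe_le_norm s)
    have h3 : α s - g s ≤ ‖α s - g s‖ := le_abs_self _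
    have h4 := norm_nonneg (α s - g s)
    nlinarith
  have h2 : ∫ s in a..t, ‖α s - g s‖ ≤ 1 / 4 := by
    refine le_trans ?_ hg
    rw [intervalIntegral.integral_of_le ht.1]
    exact setIntegral_mono_set (hα'.sub hgi).norm (Eventually.of_forall fun s => norm_nonneg _)
      (LE.le.eventuallyLE (Ioc_subset_Ioc_right ht.2))
  have h3 : ∫ s in a..t, Real.exp (-l * (t - s)) ≤ 1 / l := by
    have hd : ∀ s ∈ uIcc a t, HasDerivAt (fun s => Real.exp (-l * (t - s)) / l)
        (Real.exp (-l * (t - s))) s := fun s _ => by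
      have h0 : HasDerivAt (fun s => -l * (t - s)) l s := by
        simpa using ((hasDerivAt_id s).const_sub t).const_mul (-l)
      have := h0.exp.div_const l
      rwa [mul_div_cancel_right₀ _ hlpos.ne'] at this
    rw [intervalIntegral.integral_eq_sub_of_hasDerivAt hd (hexp.intervalIntegrable _ _)]
    have : 0 ≤ Real.exp (-l * (t - a)) / l := by positivity
    simp only [sub_self, mul_zero, Real.exp_zero]
    linarith
  rw [intervalIntegral.integral_add hsub ((hexp.intervalIntegrable _ _).const_mul _),
    intervalIntegral.integral_const_mul] at h1
  have h4 : ‖g‖ * (1 / l) ≤ 1 / 4 := by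
    rw [mul_one_div, div_le_div_iff₀ hlpos (by norm_num)]
    linarith
  have h5 := mul_le_mul_of_nonneg_left h3 (norm_nonneg g)
  linarith

/-- Solvability of the Cauchy problem for a linear system with integrable coefficients. -/
theorem exists_solution_linear_system {ι : Type*} [Fintype ι] (hab : a < b)
    {M : ι → ι → ℝ → ℂ} {h : ι → ℝ → ℂ} (hM : ∀ i k, IntervalIntegrable (M i k) volume a b)
    (hh : ∀ i, IntervalIntegrable (h i) volume a b) (z₀ : ι → ℂ) :
    ∃ z : ι → ℝ → ℂ, (∀ i, ContinuousOn (z i) (Icc a b)) ∧ ∀ i, ∀ t ∈ Icc a b,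
      z i t = z₀ i + ∫ s in a..t, (∑ k, M i k s * z k s + h i s) := by
  set α : ℝ → ℝ := fun s => ∑ i, ∑ k, ‖M i k s‖ with hαdef
  have hα : IntervalIntegrable α volume a b :=
    intervalIntegrable_sum _ fun i _ => intervalIntegrable_sum _ fun k _ => (hM i k).norm
  obtain ⟨l, hl⟩ := exists_weight_integral_le hab hα
  set X := C(Icc a b, ι → ℂ) with hX
  set ext : X → ℝ → ι → ℂ := fun w => IccExtend hab.le w with hext
  have hextc : ∀ w : X, ∀ k, Continuous fun s => ext w s k := fun w k =>
    (continuous_apply k).comp (w.continuous.Icc_extend' (h := hab.le))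
  have hextb : ∀ (w w' : X) s k, ‖ext w s k - ext w' s k‖ ≤ dist w w' := fun w w' s k => by
    rw [← dist_eq_norm]
    exact (dist_le_pi_dist _ _ k).trans (ContinuousMap.dist_apply_le_dist _)
  -- The unknown is `w = F z` with `F = exp (-l (· - a))` and `E = 1 / F`, so the sup metric on `w`
  -- is an exponentially weighted metric on `z`. In the contraction estimate `|F t| |E s|` is the
  -- kernel of `exists_weight_integral_le`.
  set E : ℝ → ℂ := fun s => (Real.exp (l * (s - a)) : ℂ) with hE
  have hEc : Continuous E := by fun_prop
  set G : X → ι → ℝ → ℂ := fun w i s => ∑ k, M i k s * (E s * ext w s k) + h i s with hG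
  have hGi : ∀ w i, IntervalIntegrable (G w i) volume a b := fun w i =>
    (intervalIntegrable_sum _ fun k _ =>
      (hM i k).mul_continuousOn (hEc.mul (hextc w k)).continuousOn).add (hh i)
  have hGit : ∀ w i, ∀ t ∈ Icc a b, IntervalIntegrable (G w i) volume a t := fun w i t ht =>
    (hGi w i).mono_set (by
      rw [uIcc_of_le ht.1, uIcc_of_le hab.le]; exact Icc_subset_Icc_right ht.2)
  set F : ℝ → ℂ := fun s => (Real.exp (-l * (s - a)) : ℂ) with hF
  have hFc : Continuous F := by fun_prop
  have hGc : ∀ w i, ContinuousOn (fun t => F t * (z₀ i + ∫ s in a..t, G w i s)) (Icc a b) := by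
    intro w i
    refine hFc.continuousOn.mul (continuousOn_const.add ?_)
    have := intervalIntegral.continuousOn_primitive_interval (f := G w i) (a := a) (b := b)
      (μ := volume) (by
        rw [uIcc_of_le hab.le]; exact (intervalIntegrable_iff_integrableOn_Icc_of_le hab.le).1 (hGi w i))
    rwa [uIcc_of_le hab.le] at this
  set Φ : X → X := fun w => ⟨fun t i => F t * (z₀ i + ∫ s in a..(t : ℝ), G w i s),
    continuous_pi fun i => (hGc w i).domRestrict⟩ with hΦ
  have hcontr : ContractingWith (1 / 2) Φ := by
    refine ⟨by rw [← NNReal.coe_lt_coe]; norm_num, LipschitzWith.of_dist_le_mul fun w w' => ?_⟩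
    have hd0 : 0 ≤ dist w w' := dist_nonneg
    rw [ContinuousMap.dist_le (by positivity)]
    intro ⟨t, ht⟩
    rw [dist_pi_le_iff (by positivity)]
    intro i
    have e1 : Φ w ⟨t, ht⟩ i - Φ w' ⟨t, ht⟩ i
        = ∫ s in a..t, F t * (∑ k, M i k s * (E s * (ext w s k - ext w' s k))) := by
      have : ∀ s, F t * (∑ k, M i k s * (E s * (ext w s k - ext w' s k)))
          = F t * (G w i s - G w' i s) := by
        intro s
        congr 1
        simp only [hG, mul_sub, Finset.sum_sub_distrib]
        ring
      simp only [this]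
      rw [intervalIntegral.integral_const_mul,
        intervalIntegral.integral_sub (hGit w i t ht) (hGit w' i t ht)]
      have hΦa : ∀ w, Φ w ⟨t, ht⟩ i = F t * (z₀ i + ∫ s in a..t, G w i s) := fun _ => rfl
      rw [hΦa, hΦa]
      ring
    rw [dist_eq_norm, e1]
    have hexp : Continuous fun s => Real.exp (-l * (t - s)) := by fun_prop
    have hle : ‖∫ s in a..t, F t * (∑ k, M i k s * (E s * (ext w s k - ext w' s k)))‖
        ≤ ∫ s in a..t, (α s * Real.exp (-l * (t - s))) * dist w w' := by
      refine intervalIntegral.norm_integral_le_of_norm_le ht.1 (Eventually.of_forall fun s _ => ?_)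
        (((hα.mono_set (by
          rw [uIcc_of_le ht.1, uIcc_of_le hab.le]
          exact Icc_subset_Icc_right ht.2)).mul_continuousOn hexp.continuousOn).mul_const _)
      have hFE : ‖F t‖ * ‖E s‖ = Real.exp (-l * (t - s)) := by
        simp only [hF, hE, Complex.norm_real, Real.norm_eq_abs, Real.abs_exp, ← Real.exp_add]
        congr 1; ring
      calc ‖F t * ∑ k, M i k s * (E s * (ext w s k - ext w' s k))‖
          ≤ ‖F t‖ * ∑ k, ‖M i k s‖ * (‖E s‖ * dist w w') := by
            rw [norm_mul]
            gcongr
            refine norm_sum_le_of_le _ fun k _ => ?_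
            rw [norm_mul, norm_mul]
            gcongr
            exact hextb w w' s k
        _ = (∑ k, ‖M i k s‖) * (‖F t‖ * ‖E s‖) * dist w w' := by
            rw [← Finset.sum_mul]; ring
        _ ≤ α s * Real.exp (-l * (t - s)) * dist w w' := by
            rw [hFE]
            gcongr
            exact Finset.single_le_sum (f := fun i => ∑ k, ‖M i k s‖)
              (fun _ _ => Finset.sum_nonneg fun _ _ => norm_nonneg _) (Finset.mem_univ i)
    refine hle.trans ?_
    rw [intervalIntegral.integral_mul_const]
    have := mul_le_mul_of_nonneg_right (hl t ht) hd0
    simpa using this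
  have hne : Nonempty X := ⟨0⟩
  set w : X := ContractingWith.fixedPoint Φ hcontr with hw
  have hfix : Φ w = w := hcontr.fixedPoint_isFixedPt
  refine ⟨fun i s => E s * ext w s i, fun i => (hEc.mul (hextc w i)).continuousOn,
    fun i t ht => ?_⟩
  have h1 : ext w t i = F t * (z₀ i + ∫ s in a..t, G w i s) := by
    have : ext w t = w ⟨t, ht⟩ := IccExtend_of_mem _ _ ht
    rw [this]
    conv_lhs => rw [← hfix]
    rfl
  have h2 : E t * F t = 1 := by
    simp only [hF, hE]
    rw [← Complex.ofReal_mul, ← Real.exp_add, show l * (t - a) + -l * (t - a) = 0 by ring,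
      Real.exp_zero, Complex.ofReal_one]
  simp only
  rw [h1, ← mul_assoc, h2, one_mul]

end LinearSystem

/-! ### Perturbation of an invertible operator with a finite-dimensional component. -/

section Perturbation

variable {E F : Type*} [NormedAddCommGroup E] [NormedSpace ℂ E] [CompleteSpace E]
  [NormedAddCommGroup F] [NormedSpace ℂ F] [CompleteSpace F] {N : ℕ}

/-- Countable generation of the filter lets unboundedness be witnessed along a sequence, where
Banach–Steinhaus applies. -/
lemma exists_eventually_opNorm_le {G : Type*} [NormedAddCommGroup G] [NormedSpace ℂ G]
    {ι : Type*} {l : Filter ι} [l.IsCountablyGenerated] {B : ι → E →L[ℂ] G} {B₀ : E →L[ℂ] G}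
    (h : ∀ x, Tendsto (fun i => B i x) l (𝓝 (B₀ x))) : ∃ K, ∀ᶠ i in l, ‖B i‖ ≤ K := by
  by_contra! hne
  obtain ⟨s, hs⟩ := l.exists_antitone_basis
  have hex : ∀ k : ℕ, ∃ i ∈ s k, (k : ℝ) < ‖B i‖ := by
    intro k
    obtain ⟨i, hi, hk⟩ := ((hne k).and_eventually (hs.1.mem_of_mem trivial : s k ∈ l)).exists
    exact ⟨i, hk, hi⟩
  choose i hi hk using hex
  have hl : Tendsto i atTop l := hs.tendsto hi
  obtain ⟨K, hK⟩ := banach_steinhaus (g := fun k => B (i k)) fun x => by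
    obtain ⟨C, hC⟩ := (((h x).comp hl).norm.bddAbove_range)
    exact ⟨C, fun k => hC ⟨k, rfl⟩⟩
  obtain ⟨k, hkK⟩ := exists_nat_gt K
  exact absurd (hK k) (not_le.2 (hkK.trans (hk k)))

/-- Eventual boundedness of the norms makes `B i (x i - x₀)` negligible. -/
lemma tendsto_apply_of_strong {G : Type*} [NormedAddCommGroup G] [NormedSpace ℂ G]
    {ι : Type*} {l : Filter ι} [l.IsCountablyGenerated] {B : ι → E →L[ℂ] G} {B₀ : E →L[ℂ] G}
    (h : ∀ x, Tendsto (fun i => B i x) l (𝓝 (B₀ x))) {x : ι → E} {x₀ : E}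
    (hx : Tendsto x l (𝓝 x₀)) : Tendsto (fun i => B i (x i)) l (𝓝 (B₀ x₀)) := by
  obtain ⟨K, hK⟩ := exists_eventually_opNorm_le h
  have h0 : Tendsto (fun i => B i (x i - x₀)) l (𝓝 0) := by
    refine squeeze_zero_norm' (a := fun i => K * ‖x i - x₀‖) ?_ ?_
    · filter_upwards [hK] with i hi using (B i).le_of_opNorm_le hi _
    · simpa using (tendsto_iff_norm_sub_tendsto_zero.1 hx).const_mul K
  simpa using h0.add (h x₀)

/-- On a finite-dimensional domain the operator norm is dominated by the values on the basis
vectors. -/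
lemma tendsto_clm_of_strong {G : Type*} [NormedAddCommGroup G] [NormedSpace ℂ G]
    {ι : Type*} {l : Filter ι} {S : ι → (Fin N → ℂ) →L[ℂ] G} {S₀ : (Fin N → ℂ) →L[ℂ] G}
    (h : ∀ k, Tendsto (fun i => S i (Pi.single k 1)) l (𝓝 (S₀ (Pi.single k 1)))) :
    Tendsto S l (𝓝 S₀) := by
  rw [tendsto_iff_norm_sub_tendsto_zero]
  have hle : ∀ i, ‖S i - S₀‖ ≤ ∑ k, ‖S i (Pi.single k 1) - S₀ (Pi.single k 1)‖ := by
    intro i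
    refine ContinuousLinearMap.opNorm_le_bound _ (Finset.sum_nonneg fun _ _ => norm_nonneg _)
      fun c => ?_
    have : (S i - S₀) c = ∑ k, c k • (S i (Pi.single k 1) - S₀ (Pi.single k 1)) := by
      conv_lhs => rw [pi_eq_sum_univ' c]
      simp [map_sum, map_smul, smul_sub]
    rw [this, Finset.sum_mul]
    refine norm_sum_le_of_le _ fun k _ => ?_
    rw [norm_smul, mul_comm]
    gcongr
    exact norm_le_pi_norm c k
  refine squeeze_zero (fun i => norm_nonneg _) hle ?_
  rw [← Finset.sum_const_zero (s := (Finset.univ : Finset (Fin N)))]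
  exact tendsto_finsetSum _ fun k _ => tendsto_iff_norm_sub_tendsto_zero.1 (h k)

lemma tendsto_clm_apply {G H : Type*} [NormedAddCommGroup G] [NormedSpace ℂ G]
    [NormedAddCommGroup H] [NormedSpace ℂ H] {ι : Type*} {l : Filter ι} {S : ι → G →L[ℂ] H}
    {S₀ : G →L[ℂ] H} {x : ι → G} {x₀ : G} (hS : Tendsto S l (𝓝 S₀)) (hx : Tendsto x l (𝓝 x₀)) :
    Tendsto (fun i => S i (x i)) l (𝓝 (S₀ x₀)) :=
  (isBoundedBilinearMap_apply.continuous.tendsto (S₀, x₀)).comp (hS.prodMk_nhds hx)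

/-- A strongly convergent perturbation of the finite-dimensional part and a norm convergent
perturbation of the other part preserve unique solvability, and the solutions converge. -/
theorem eventually_bijective_and_tendsto {ι : Type*} {l : Filter ι} [l.IsCountablyGenerated]
    {L : ι → E →L[ℂ] F} {L₀ : E →L[ℂ] F} {B : ι → E →L[ℂ] (Fin N → ℂ)} {B₀ : E →L[ℂ] (Fin N → ℂ)}
    (hbij : Function.Bijective (L₀.prod B₀)) (hL : Tendsto L l (𝓝 L₀))
    (hB : ∀ x, Tendsto (fun i => B i x) l (𝓝 (B₀ x))) :
    (∀ᶠ i in l, Function.Bijective ((L i).prod (B i))) ∧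
      ∀ (f : ι → F) (f₀ : F) (c : ι → Fin N → ℂ) (c₀ : Fin N → ℂ) (y : ι → E) (y₀ : E),
        Tendsto f l (𝓝 f₀) → Tendsto c l (𝓝 c₀) → (∀ᶠ i in l, L i (y i) = f i ∧ B i (y i) = c i) →
        L₀ y₀ = f₀ → B₀ y₀ = c₀ → Tendsto y l (𝓝 y₀) := by
  let T : E ≃L[ℂ] F × (Fin N → ℂ) := ContinuousLinearEquiv.ofBijective (L₀.prod B₀)
    (LinearMap.ker_eq_bot.2 hbij.1) (LinearMap.range_eq_top.2 hbij.2)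
  have hT : (T : E →L[ℂ] F × (Fin N → ℂ)) = L₀.prod B₀ :=
    ContinuousLinearEquiv.coe_ofBijective _ _ _
  have hprod : Tendsto (fun i => (L i).prod B₀) l (𝓝 (T : E →L[ℂ] F × (Fin N → ℂ))) := by
    have e : ∀ M : E →L[ℂ] F, M.prod B₀ = (ContinuousLinearMap.inl ℂ F (Fin N → ℂ)) ∘L M +
        (ContinuousLinearMap.inr ℂ F (Fin N → ℂ)) ∘L B₀ := fun M => by ext x <;> simp
    have hc : Continuous fun M : E →L[ℂ] F => M.prod B₀ := by
      rw [funext e]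
      exact (continuous_const.clm_comp continuous_id).add continuous_const
    rw [hT]
    exact (hc.tendsto L₀).comp hL
  -- `inverse` has the value `0` at a non-invertible operator, so the inverse identities hold only
  -- eventually.
  set U : ι → F × (Fin N → ℂ) →L[ℂ] E := fun i => ((L i).prod B₀).inverse with hU
  have hUt : Tendsto U l (𝓝 (T.symm : F × (Fin N → ℂ) →L[ℂ] E)) := by
    have := (contDiffAt_map_inverse (n := 0) T).continuousAt.tendsto.comp hprod
    rwa [ContinuousLinearMap.inverse_equiv] at this
  have hUinv : ∀ᶠ i in l, (∀ z, L i (U i z) = z.1 ∧ B₀ (U i z) = z.2) ∧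
      ∀ y, U i (L i y, B₀ y) = y := by
    filter_upwards [hprod (ContinuousLinearEquiv.nhds T)] with i ⟨e, he⟩
    replace he : (e : E →L[ℂ] F × (Fin N → ℂ)) = (L i).prod B₀ := he
    have h1 : U i = e.symm := by
      rw [← ContinuousLinearMap.inverse_equiv, he]
    have h2 : ∀ y, e y = (L i y, B₀ y) := fun y => by
      rw [← ContinuousLinearMap.prod_apply, ← he]; rfl
    refine ⟨fun z => ?_, fun y => ?_⟩
    · have := h2 (e.symm z)
      rw [e.apply_symm_apply] at this
      rw [h1]
      exact ⟨(congrArg Prod.fst this).symm, (congrArg Prod.snd this).symm⟩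
    · rw [h1, ← h2]; exact e.symm_apply_apply y
  -- Where `U i` is a genuine inverse, `S i` sends `d` to the `B i`-data of the solution of `L i y =
  -- 0` with `B₀ y = d`. In the limit both sets of data agree, so `S` tends to the identity.
  set S : ι → (Fin N → ℂ) →L[ℂ] (Fin N → ℂ) := fun i =>
    B i ∘L U i ∘L ContinuousLinearMap.inr ℂ F (Fin N → ℂ) with hS
  have hUz : ∀ (z : ι → F × (Fin N → ℂ)) z₀, Tendsto z l (𝓝 z₀) →
      Tendsto (fun i => U i (z i)) l (𝓝 (T.symm z₀)) := fun z z₀ hz => tendsto_clm_apply hUt hz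
  have hB0 : ∀ z, B₀ (T.symm z) = z.2 := fun z => by
    have : (L₀.prod B₀) (T.symm z) = z := by rw [← hT]; exact T.apply_symm_apply z
    exact congrArg Prod.snd this
  have hSt : Tendsto S l (𝓝 1) := by
    refine tendsto_clm_of_strong fun k => ?_
    have := tendsto_apply_of_strong hB
      (hUz (fun _ => (0, Pi.single k 1)) (0, Pi.single k 1) tendsto_const_nhds)
    rw [hB0] at this
    exact this
  have hSu : ∀ᶠ i in l, IsUnit (S i) := hSt (Units.nhds 1)
  have hV : Tendsto (fun i => Ring.inverse (S i)) l (𝓝 1) := by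
    have := (NormedRing.inverse_continuousAt
      (1 : ((Fin N → ℂ) →L[ℂ] (Fin N → ℂ))ˣ)).tendsto.comp hSt
    simpa [Function.comp_def] using this
  -- Any `y` with `L i y = f` is `U i (f, d)` with `d = B₀ y`. The condition `B i y = c` therefore
  -- becomes the finite system `S i d = c - B i (U i (f, 0))`.
  have hsplit : ∀ i f d, B i (U i (f, d)) = B i (U i (f, 0)) + S i d := by
    intro i f d
    have : ((f, d) : F × (Fin N → ℂ)) = (f, 0) + (0, d) := by simp
    rw [this, map_add, map_add]
    rfl
  refine ⟨?_, ?_⟩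
  · filter_upwards [hUinv, hSu] with i ⟨hi, hi'⟩ hs
    refine ⟨(injective_iff_map_eq_zero _).2 fun y hy => ?_, fun ⟨f, c⟩ => ?_⟩
    · have h1 : L i y = 0 := congrArg Prod.fst hy
      have h2 : B i y = 0 := congrArg Prod.snd hy
      have h3 := hi' y
      have h4 : S i (B₀ y) = 0 := by
        have := hsplit i 0 (B₀ y)
        rw [h1] at h3
        rw [h3, h2] at this
        rw [show ((0 : F), (0 : Fin N → ℂ)) = 0 from rfl, map_zero, map_zero, zero_add] at this
        exact this.symm
      have h5 : B₀ y = 0 := by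
        have : (Ring.inverse (S i) * S i) (B₀ y) = 0 := by
          rw [mul_apply_eq_comp, h4, map_zero]
        rwa [Ring.inverse_mul_cancel _ hs] at this
      rw [← h3, h1, h5]
      exact map_zero _
    · refine ⟨U i (f, Ring.inverse (S i) (c - B i (U i (f, 0)))), ?_⟩
      rw [ContinuousLinearMap.prod_apply, (hi _).1, hsplit i f (Ring.inverse (S i) _), ← mul_apply_eq_comp,
        Ring.mul_inverse_cancel _ hs]
      simp
  · intro f f₀ c c₀ y y₀ hf hc hy h₁ h₂
    -- `B i (U i (f i, 0))` tends to `B₀ (T.symm (f₀, 0)) = 0`, so the unknown `d` tends to `c₀`.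
    have hd : Tendsto (fun i => Ring.inverse (S i) (c i - B i (U i (f i, 0)))) l (𝓝 c₀) := by
      have h3 := tendsto_apply_of_strong hB
        (hUz (fun i => (f i, 0)) (f₀, 0) (hf.prodMk_nhds tendsto_const_nhds))
      rw [hB0] at h3
      simpa using tendsto_clm_apply hV (hc.sub h3)
    have hy0 : T.symm (f₀, c₀) = y₀ := by
      rw [ContinuousLinearEquiv.symm_apply_eq]
      have : T y₀ = (L₀.prod B₀) y₀ := by rw [← hT]; rfl
      rw [this, ContinuousLinearMap.prod_apply, h₁, h₂]
    rw [← hy0]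
    refine (hUz _ _ (hf.prodMk_nhds hd)).congr' ?_
    filter_upwards [hUinv, hSu, hy] with i ⟨_, hi'⟩ hs ⟨h4, h5⟩
    have h6 := hi' (y i)
    rw [h4] at h6
    have h7 := hsplit i (f i) (B₀ (y i))
    rw [h6, h5] at h7
    rw [h7, add_sub_cancel_left, ← mul_apply_eq_comp, Ring.inverse_mul_cancel _ hs]
    exact h6

end Perturbation

/-! ### The Cauchy problem in Sobolev spaces and solvability from uniqueness. -/

section Cauchy

variable {a b : ℝ} {p : ℝ≥0∞} [Fact (1 ≤ p)] {n m r : ℕ}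

lemma sobolevSubmodule_mono {k l : ℕ} (h : k ≤ l) :
    sobolevSubmodule a b p l ≤ sobolevSubmodule a b p k :=
  fun _ hu j hj => hu j (hj.trans h)

lemma toLp_mem (u : SobolevSpace a b p n) : toLp u ∈ sobolevSubmodule a b p n := u.2

lemma HasWeakDeriv.mem_sobolevSubmodule_succ {k : ℕ} {u v : LpSpace a b p}
    (h : HasWeakDeriv 1 u v) (hv : v ∈ sobolevSubmodule a b p k) :
    u ∈ sobolevSubmodule a b p (k + 1) := by
  obtain ⟨w, hw, -⟩ := exists_of_hasWeakDeriv (v := ofMem v hv) h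
  rw [← hw]
  exact toLp_mem w

/-- The space `W^{k+1}_p` is closed under products. -/
lemma mul_mem_sobolevSubmodule (hab : a < b) {k : ℕ} {u v w : LpSpace a b p}
    (hu : u ∈ sobolevSubmodule a b p (k + 1)) (hv : v ∈ sobolevSubmodule a b p (k + 1))
    (hw : ∀ᵐ t ∂(intervalMeasure a b), w t = u t * v t) :
    w ∈ sobolevSubmodule a b p (k + 1) := by
  obtain ⟨C, -, h⟩ := exists_mul_succ hab (exists_mul hab p k)
  obtain ⟨w', hw', -⟩ := h (ofMem u hu) (ofMem v hv)
  have : w = toLp w' := Lp.ext (by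
    filter_upwards [hw, hw'] with t h1 h2
    rw [h1, h2]
    rfl)
  rw [this]
  exact toLp_mem w'

lemma memLp_mul_continuousOn (u : LpSpace a b p) {g : ℝ → ℂ} (hg : ContinuousOn g (Icc a b)) :
    MemLp (fun t => u t * g t) p (intervalMeasure a b) := by
  obtain ⟨C, hC⟩ := isCompact_Icc.exists_bound_of_continuousOn hg
  refine (Lp.memLp u).of_le_mul (c := C) ((Lp.aestronglyMeasurable u).mul
    ((hg.mono Ioo_subset_Icc_self).aestronglyMeasurable measurableSet_Ioo)) ?_
  filter_upwards [ae_mem_Ioo] with t ht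
  rw [norm_mul, mul_comm]
  exact mul_le_mul_of_nonneg_right (hC t (Ioo_subset_Icc_self ht)) (norm_nonneg _)

/-- Iterated primitives gain regularity. -/
lemma mem_sobolevSubmodule_add {k : ℕ} {u : ℕ → LpSpace a b p}
    (hu : ∀ j < r, HasWeakDeriv 1 (u j) (u (j + 1))) (hr : u r ∈ sobolevSubmodule a b p k) :
    ∀ d ≤ r, u (r - d) ∈ sobolevSubmodule a b p (k + d) := by
  intro d
  induction d with
  | zero => intro _; simpa using hr
  | succ d ih =>
    intro hd
    have h := hu (r - (d + 1)) (by omega)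
    rw [show r - (d + 1) + 1 = r - d by omega] at h
    exact h.mem_sobolevSubmodule_succ (ih (by omega))

lemma hasWeakDeriv_iterate {u : ℕ → LpSpace a b p}
    (hu : ∀ j < r, HasWeakDeriv 1 (u j) (u (j + 1))) : ∀ j ≤ r, HasWeakDeriv j (u 0) (u j) := by
  intro j
  induction j with
  | zero => intro _; exact hasWeakDeriv_self _
  | succ j ih => intro hj; exact (ih (by omega)).comp (hu j (by omega))

/-- The Cauchy problem for the differential expression is solvable. -/
theorem exists_cauchy_solution (hab : a < b) (A : Fin r → MatSobolev a b p n m)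
    (f : VecSobolev a b p n m) (z₀ : Fin r → Fin m → ℂ) :
    ∃ (y : VecSobolev a b p (n + r) m) (z : Fin r → Fin m → ℝ → ℂ), diffOp hab A y = f ∧
      (∀ j i, ContinuousOn (z j i) (Icc a b)) ∧ (∀ j i, z j i a = z₀ j i) ∧
      ∀ (j : Fin r) i, ∀ᵐ t ∂(intervalMeasure a b), (y i).deriv (j : ℕ) t = z j i t := by
  -- The companion system for `z (j, i) = y_i^{(j)}`: row `j` with `j + 1 < r` reads `z_j' =
  -- z_{j+1}`, and the last row carries the equation itself.
  obtain ⟨z, hzc, hz⟩ := exists_solution_linear_system (ι := Fin r × Fin m) hab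
    (M := fun q q' t => if (q.1 : ℕ) + 1 < r then
      (if (q'.1 : ℕ) = q.1 + 1 ∧ q'.2 = q.2 then 1 else 0) else -toLp (A q'.1 q.2 q'.2) t)
    (h := fun q t => if (q.1 : ℕ) + 1 < r then 0 else toLp (f q.2) t)
    (fun q q' => by
      by_cases h : (q.1 : ℕ) + 1 < r
      · simp only [h, if_true]; exact intervalIntegrable_const
      · simp only [h, if_false]; exact (intervalIntegrable_coe hab.le _).neg)
    (fun q => by
      by_cases h : (q.1 : ℕ) + 1 < r
      · simp only [h, if_true]; exact intervalIntegrable_const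
      · simp only [h, if_false]; exact intervalIntegrable_coe hab.le _)
    (fun q => z₀ q.1 q.2)
  set g : Fin m → ℝ → ℂ := fun i t =>
    toLp (f i) t - ∑ j : Fin r, ∑ k : Fin m, toLp (A j i k) t * z (j, k) t with hg
  -- `x` continues the chain of derivatives to order `r`, where the equation prescribes the value
  -- `g`.
  set x : ℕ → Fin m → ℝ → ℂ := fun j i t => if h : j < r then z (⟨j, h⟩, i) t else g i t with hx
  have hxz : ∀ (j : Fin r) i, x j i = z (j, i) := fun j i => by
    funext t
    simp [hx]
  have hxr : ∀ i, x r i = g i := fun i => by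
    funext t
    simp [hx]
  have hint : ∀ (j : Fin r) i, ∀ t ∈ Icc a b,
      z (j, i) t = z₀ j i + ∫ s in a..t, x (j + 1) i s := by
    intro j i t ht
    rw [hz (j, i) t ht]
    congr 2
    funext s
    by_cases h : (j : ℕ) + 1 < r
    · simp only [h, if_true, hx, dif_pos]
      rw [add_zero, Finset.sum_eq_single (⟨j + 1, h⟩, i)]
      · simp
      · rintro ⟨j', i'⟩ _ hne
        rw [if_neg, zero_mul]
        rintro ⟨h1, h2⟩
        exact hne (Prod.ext (Fin.ext h1) h2)
      · simp
    · simp only [h, if_false, hx, dif_neg, not_false_eq_true, hg]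
      rw [Fintype.sum_prod_type]
      simp only [neg_mul, Finset.sum_neg_distrib]
      ring
  have hgm : ∀ i, MemLp (g i) p (intervalMeasure a b) := fun i =>
    (Lp.memLp (toLp (f i))).sub (memLp_finsetSum _ fun j _ => memLp_finsetSum _ fun k _ =>
      memLp_mul_continuousOn _ (hzc (j, k)))
  have hxm : ∀ j i, MemLp (x j i) p (intervalMeasure a b) := by
    intro j i
    by_cases h : j < r
    · rw [hxz ⟨j, h⟩ i]; exact memLp_of_continuousOn (hzc _)
    · have : x j i = g i := by funext t; simp [hx, h]
      rw [this]; exact hgm i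
  set u : ℕ → Fin m → LpSpace a b p := fun j i => (hxm j i).toLp with hu
  have hux : ∀ j i, ∀ᵐ t ∂(intervalMeasure a b), u j i t = x j i t := fun j i =>
    (hxm j i).coeFn_toLp
  have hud : ∀ i, ∀ j < r, HasWeakDeriv 1 (u j i) (u (j + 1) i) := by
    intro i j hj
    refine .of_primitive hab (z₀ ⟨j, hj⟩ i) ?_
    filter_upwards [hux j i, ae_mem_Ioo] with t h1 hm
    have ht := Ioo_subset_Icc_self hm
    rw [h1, hxz ⟨j, hj⟩ i, hint ⟨j, hj⟩ i t ht]
    congr 1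
    refine intervalIntegral.integral_congr_ae ?_
    filter_upwards [ae_restrict_Ioc_of_ae (hux (j + 1) i) ht] with s hs hst
    exact (hs hst).symm
  -- Bootstrap: if `u r` is in `W^k_p`, the functions `u j` with `j < r` are in `W^{k+1}_p`. For `k
  -- + 1 ≤ n` so are their products with the coefficients, and the equation then puts `u r` in
  -- `W^{k+1}_p`.
  have hmem : ∀ k ≤ n, ∀ i, u r i ∈ sobolevSubmodule a b p k := by
    intro k
    induction k with
    | zero =>
      intro _ i l hl
      obtain rfl : l = 0 := by omega
      exact ⟨_, hasWeakDeriv_self _⟩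
    | succ k ih =>
      intro hk i
      have hw : ∀ j : Fin r, ∀ l, (memLp_mul_continuousOn (toLp (A j i l)) (hzc (j, l))).toLp
          ∈ sobolevSubmodule a b p (k + 1) := by
        intro j l
        refine mul_mem_sobolevSubmodule hab (u := toLp (A j i l)) (v := u j l)
          (sobolevSubmodule_mono hk (toLp_mem _)) ?_ ?_
        · have := mem_sobolevSubmodule_add (u := fun j => u j l) (hud l) (ih (by omega) l)
            (r - j) (by omega)
          rw [show r - (r - (j : ℕ)) = j by omega] at this
          exact sobolevSubmodule_mono (by omega) this
        · filter_upwards [(memLp_mul_continuousOn (toLp (A j i l)) (hzc (j, l))).coeFn_toLp,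
            hux j l] with t h1 h2
          rw [h1, h2, hxz]
      have e : u r i = toLp (f i) - ∑ j : Fin r, ∑ l : Fin m,
          (memLp_mul_continuousOn (toLp (A j i l)) (hzc (j, l))).toLp := by
        refine Lp.ext ?_
        have h1 := ae_all_iff.2 fun j : Fin r => ae_all_iff.2 fun l : Fin m =>
          (memLp_mul_continuousOn (toLp (A j i l)) (hzc (j, l))).coeFn_toLp
        have h2 := Lp.coeFn_sub (toLp (f i)) (∑ j : Fin r, ∑ l : Fin m,
          (memLp_mul_continuousOn (toLp (A j i l)) (hzc (j, l))).toLp)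
        have h3 := Lp.coeFn_finsetSum Finset.univ fun j : Fin r => ∑ l : Fin m,
          (memLp_mul_continuousOn (toLp (A j i l)) (hzc (j, l))).toLp
        have h4 := ae_all_iff.2 fun j : Fin r => Lp.coeFn_finsetSum Finset.univ fun l : Fin m =>
          (memLp_mul_continuousOn (toLp (A j i l)) (hzc (j, l))).toLp
        filter_upwards [h1, h2, h3, h4, hux r i] with t h1 h2 h3 h4 h5
        rw [h5, hxr, h2, Pi.sub_apply, h3, Finset.sum_apply]
        simp only [h4, Finset.sum_apply, h1, hg]
      rw [e]
      exact Submodule.sub_mem _ (sobolevSubmodule_mono hk (toLp_mem _))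
        (Submodule.sum_mem _ fun j _ => Submodule.sum_mem _ fun l _ => hw j l)
  have hmem0 : ∀ i, u 0 i ∈ sobolevSubmodule a b p (n + r) := fun i => by
    simpa using mem_sobolevSubmodule_add (u := fun j => u j i) (hud i) (hmem n le_rfl i) r le_rfl
  have hyd : ∀ i, ∀ j ≤ r, (ofMem (u 0 i) (hmem0 i)).deriv j = u j i := fun i j hj =>
    deriv_eq (by omega) (hasWeakDeriv_iterate (u := fun j => u j i) (hud i) j hj)
  refine ⟨fun i => ofMem (u 0 i) (hmem0 i), fun j i => z (j, i), ?_, fun j i => hzc (j, i),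
    fun j i => ?_, fun j i => ?_⟩
  · rw [diffOp_eq_iff]
    have h1 := ae_all_iff.2 fun j : Fin r => ae_all_iff.2 fun i => hux j i
    have h2 := ae_all_iff.2 fun i => hux r i
    filter_upwards [h1, h2] with t h1 h2
    funext i
    have hdj : ∀ (j : Fin r) i, (ofMem (u 0 i) (hmem0 i)).deriv (j : ℕ) t = z (j, i) t :=
      fun j i => by rw [hyd i j j.2.le, h1, hxz]
    have hdr : (ofMem (u 0 i) (hmem0 i)).deriv r t = g i t := by rw [hyd i r le_rfl, h2, hxr]
    simp [diffExpr, vecDeriv, matValue, Matrix.mulVec, dotProduct, hdj, hdr, hg, deriv_zero_eq]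
  · change z (j, i) a = z₀ j i
    rw [hz (j, i) a ⟨le_rfl, hab.le⟩, intervalIntegral.integral_same, add_zero]
  · filter_upwards [hux j i] with t ht
    rw [hyd i j j.2.le, ht, hxz]

/-- If the homogeneous boundary-value problem has only the trivial solution, then the problem is
uniquely solvable. -/
theorem OnlyTrivialSolution.bijective (hab : a < b) {A : Fin r → MatSobolev a b p n m}
    {B : VecSobolev a b p (n + r) m →L[ℂ] (Fin (r * m) → ℂ)} (h : OnlyTrivialSolution A B) :
    Function.Bijective ((diffOp hab A).prod B) := by
  have h' : ∀ y, diffOp hab A y = 0 → B y = 0 → y = 0 := fun y h1 h2 =>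
    h y ((isSolution_iff hab).2 ⟨h1, h2⟩)
  refine ⟨(injective_iff_map_eq_zero _).2 fun y hy =>
    h' y (congrArg Prod.fst hy) (congrArg Prod.snd hy), ?_⟩
  -- Fundamental solutions: `y q` has the `q`-th unit vector as its Cauchy data at `a`.
  choose y z hyL hzc hza hyz using fun q : Fin r × Fin m =>
    exists_cauchy_solution hab A 0 (fun j i => if q = (j, i) then 1 else 0)
  let Y : (Fin r × Fin m → ℂ) →ₗ[ℂ] VecSobolev a b p (n + r) m :=
    Fintype.linearCombination ℂ y
  have hY : ∀ c, Y c = ∑ q, c q • y q := fun c => Fintype.linearCombination_apply ℂ y c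
  have hYL : ∀ c, diffOp hab A (Y c) = 0 := fun c => by
    rw [hY, map_sum]
    exact Finset.sum_eq_zero fun q _ => by rw [map_smul, hyL, smul_zero]
  have hinj : Function.Injective ((B : _ →ₗ[ℂ] (Fin (r * m) → ℂ)) ∘ₗ Y) := by
    refine (injective_iff_map_eq_zero _).2 fun c hc => ?_
    have hYc : Y c = 0 := h' _ (hYL c) hc
    funext ⟨j, i⟩
    have hj : (j : ℕ) + 0 ≤ n + r := by omega
    have h1 : derivCLM (l := 0) hj (Y c i) = ∑ q, c q • derivCLM (l := 0) hj (y q i) := by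
      rw [hY, Finset.sum_apply, map_sum]
      exact Finset.sum_congr rfl fun q _ => by rw [Pi.smul_apply, map_smul]
    have h2 : ∀ᵐ t ∂(intervalMeasure a b), ∑ q, c q * z q j i t = 0 := by
      rw [hYc, Pi.zero_apply, map_zero] at h1
      have h3 := coeFn_sum Finset.univ fun q => c q • derivCLM (l := 0) hj (y q i)
      have h4 := ae_all_iff.2 fun q => coeFn_smul (c q) (derivCLM (l := 0) hj (y q i))
      have h5 := ae_all_iff.2 fun q => hyz q j i
      rw [← h1, map_zero] at h3
      filter_upwards [h3, h4, h5, Lp.coeFn_zero ℂ p (intervalMeasure a b)] with t h3 h4 h5 h6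
      rw [h6, Pi.zero_apply] at h3
      simp only [h4, toLp_derivCLM, h5] at h3
      exact h3.symm
    -- The combination vanishes almost everywhere, hence everywhere by continuity. Its value at `a`
    -- is then the coefficient `c (j, i)`.
    have h3 : EqOn (fun t => ∑ q, c q * z q j i t) (fun _ => 0) (Icc a b) := by
      refine Measure.eqOn_Icc_of_ae_eq volume hab.ne ?_
        (continuousOn_finsetSum _ fun q _ => continuousOn_const.mul (hzc q j i))
        continuousOn_const
      rw [← Measure.restrict_congr_set Ioo_ae_eq_Icc]
      exact h2
    have h4 := h3 (left_mem_Icc.2 hab.le)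
    simp only [hza] at h4
    simpa using h4
  -- Domain and target both have dimension `r * m`, so injectivity gives surjectivity. A particular
  -- solution can then be corrected to meet any boundary data.
  have hsurj := (LinearMap.injective_iff_surjective_of_finrank_eq_finrank (by simp)).1 hinj
  rintro ⟨f, c⟩
  obtain ⟨y₁, -, hy₁, -⟩ := exists_cauchy_solution hab A f 0
  obtain ⟨d, hd⟩ := hsurj (c - B y₁)
  have hd' : B (Y d) = c - B y₁ := hd
  refine ⟨y₁ + Y d, ?_⟩
  rw [ContinuousLinearMap.prod_apply, map_add, map_add, hy₁, hYL, hd']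
  simp

end Cauchy

/-! ### Monomials as elements of Sobolev spaces. -/

section Monomials

variable {a b : ℝ} {p : ℝ≥0∞} [Fact (1 ≤ p)] {n : ℕ}

/-- There are elements of `W^N_p` whose `j`-th derivative is `1` and whose derivatives of higher
orders vanish. -/
lemma exists_monomial (hab : a < b) (p : ℝ≥0∞) [Fact (1 ≤ p)] (N j : ℕ) :
    ∃ u : SobolevSpace a b p N, (j ≤ N → ∀ᵐ t ∂(intervalMeasure a b), u.deriv j t = 1) ∧
      ∀ k, j < k → k ≤ N → u.deriv k = 0 := by
  have hone : MemLp (fun _ : ℝ => (1 : ℂ)) p (intervalMeasure a b) := memLp_const 1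
  let prim : LpSpace a b p → LpSpace a b p := fun v =>
    (memLp_of_continuousOn (continuousOn_primitive v)).toLp
  have hprim : ∀ v, HasWeakDeriv 1 (prim v) v := fun v => .of_primitive hab 0 (by
    filter_upwards [(memLp_of_continuousOn (p := p) (continuousOn_primitive v)).coeFn_toLp] with t ht
    rw [ht, zero_add])
  have hconst : HasWeakDeriv 1 (hone.toLp : LpSpace a b p) 0 := .of_primitive hab 1 (by
    filter_upwards [hone.coeFn_toLp, ae_mem_Ioo] with t ht hm
    have hz : ∫ s in a..t, (0 : LpSpace a b p) s = ∫ s in a..t, (0 : ℂ) := by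
      refine intervalIntegral.integral_congr_ae ?_
      have h0 : ∀ᵐ s ∂(intervalMeasure a b), (0 : LpSpace a b p) s = 0 := by
        filter_upwards [Lp.coeFn_zero ℂ p (intervalMeasure a b)] with s hs
        rw [hs, Pi.zero_apply]
      exact ae_restrict_Ioc_of_ae h0 (Ioo_subset_Icc_self hm)
    rw [ht, hz, intervalIntegral.integral_zero, add_zero])
  -- `e k` is `(t - a)^k / k!`, so `u i` is the `i`-th derivative of `(t - a)^j / j!`.
  let e : ℕ → LpSpace a b p := fun k => prim^[k] hone.toLp
  let u : ℕ → LpSpace a b p := fun i => if i ≤ j then e (j - i) else 0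
  have hu : ∀ i, HasWeakDeriv 1 (u i) (u (i + 1)) := by
    intro i
    rcases lt_trichotomy i j with h | rfl | h
    · have h1 : u i = prim (u (i + 1)) := by
        simp only [u, if_pos h.le, if_pos (Nat.succ_le_of_lt h), e]
        rw [← Function.iterate_succ_apply' prim]
        congr 2
        omega
      rw [h1]
      exact hprim _
    · have h1 : u i = hone.toLp := by simp [u, e]
      have h2 : u (i + 1) = 0 := by simp [u]
      rw [h1, h2]
      exact hconst
    · have h1 : u i = 0 := by simp [u, h.not_ge]
      have h2 : u (i + 1) = 0 := by simp [u, show ¬ i + 1 ≤ j by omega]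
      rw [h1, h2]
      exact hasWeakDeriv_zero 1
  have hk : ∀ k, HasWeakDeriv k (u 0) (u k) := fun k =>
    hasWeakDeriv_iterate (r := k) (fun j _ => hu j) k le_rfl
  refine ⟨ofMem (u 0) fun k _ => ⟨u k, hk k⟩, fun hj => ?_, fun k hjk hkN => ?_⟩
  · rw [deriv_eq (u := ofMem (u 0) fun k _ => ⟨u k, hk k⟩) hj (hk j)]
    have h1 : u j = hone.toLp := by simp [u, e]
    rw [h1]
    exact hone.coeFn_toLp
  · rw [deriv_eq (u := ofMem (u 0) fun k _ => ⟨u k, hk k⟩) hkN (hk k)]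
    simp [u, hjk.not_ge]

end Monomials

/-! ### Recovering the coefficients from the operator. -/

section Coefficients

variable {a b : ℝ} {p : ℝ≥0∞} [Fact (1 ≤ p)] {n m r : ℕ}

lemma diffOp_sub_apply (hab : a < b) (A A' : Fin r → MatSobolev a b p n m)
    (y : VecSobolev a b p (n + r) m) (i : Fin m) :
    (diffOp hab A - diffOp hab A') y i = ∑ j : Fin r, ∑ k : Fin m,
      mulCLM hab (A j i k - A' j i k) (derivCLM (j := (j : ℕ)) (by omega) (y k)) := by
  rw [sub_apply, Pi.sub_apply, diffOp_apply, diffOp_apply, add_sub_add_left_eq_sub,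
    ← Finset.sum_sub_distrib]
  refine Finset.sum_congr rfl fun j _ => ?_
  rw [← Finset.sum_sub_distrib]
  exact Finset.sum_congr rfl fun k _ => by rw [map_sub, sub_apply]

/-- The sum of the norms of the differences of the coefficients. -/
def coeffDist (A A' : Fin r → MatSobolev a b p n m) : ℝ :=
  ∑ i, ∑ j, ∑ k, ‖A j i k - A' j i k‖

lemma coeffDist_nonneg (A A' : Fin r → MatSobolev a b p n m) : 0 ≤ coeffDist A A' :=
  Finset.sum_nonneg fun _ _ => Finset.sum_nonneg fun _ _ => Finset.sum_nonneg fun _ _ =>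
    norm_nonneg _

/-- The bound is linear in `coeffDist`, so it can be absorbed by the comparison function `1 +
coeffDist` even before the coefficients are known to be bounded. -/
lemma norm_diffOp_sub_apply_le (hab : a < b) (A A' : Fin r → MatSobolev a b p n m)
    (y : VecSobolev a b p (n + r) m) :
    ‖(diffOp hab A - diffOp hab A') y‖
      ≤ ‖mulCLM (p := p) (n := n) hab‖ * coeffDist A A' * ‖y‖ := by
  have hC := norm_nonneg (mulCLM (p := p) (n := n) hab)
  have hd := coeffDist_nonneg A A'
  refine (pi_norm_le_iff_of_nonneg (by positivity)).2 fun i => ?_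
  rw [diffOp_sub_apply]
  calc ‖∑ j : Fin r, ∑ k : Fin m,
        mulCLM hab (A j i k - A' j i k) (derivCLM (j := (j : ℕ)) (by omega) (y k))‖
      ≤ ∑ j : Fin r, ∑ k : Fin m,
        ‖mulCLM (p := p) (n := n) hab‖ * ‖A j i k - A' j i k‖ * ‖y‖ := by
        refine norm_sum_le_of_le _ fun j _ => norm_sum_le_of_le _ fun k _ => ?_
        refine ((mulCLM hab).le_opNorm₂ _ _).trans ?_
        gcongr
        exact (norm_derivCLM_le _ _).trans (norm_le_pi_norm y k)
    _ = ‖mulCLM (p := p) (n := n) hab‖ * (∑ j, ∑ k, ‖A j i k - A' j i k‖) * ‖y‖ := by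
        simp only [Finset.mul_sum, Finset.sum_mul]
    _ ≤ _ := by
        gcongr
        exact Finset.single_le_sum (f := fun i => ∑ j, ∑ k, ‖A j i k - A' j i k‖)
          (fun _ _ => Finset.sum_nonneg fun _ _ => Finset.sum_nonneg fun _ _ => norm_nonneg _)
          (Finset.mem_univ i)

open Asymptotics in
/-- Coefficients are controlled by the values of the differential expression on monomials. -/
lemma isLittleO_coeff (hab : a < b) {l : Filter ℝ} {A : ℝ → Fin r → MatSobolev a b p n m}
    {A₀ : Fin r → MatSobolev a b p n m} {g : ℝ → ℝ}
    (h : ∀ y, (fun ε => (diffOp hab (A ε) - diffOp hab A₀) y) =o[l] g) (i k : Fin m) :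
    ∀ (N : ℕ) (j : Fin r), (j : ℕ) = N → (fun ε => A ε j i k - A₀ j i k) =o[l] g := by
  intro N
  induction N using Nat.strong_induction_on with
  | _ N ih =>
    rintro j rfl
    obtain ⟨u, hu1, hu0⟩ := exists_monomial hab p (n + r) (j : ℕ)
    -- On the monomial of degree `j` placed in component `k`, the terms of order above `j` vanish
    -- and the term of order `j` is the coefficient itself. The lower terms are covered by the
    -- induction hypothesis.
    have hval : ∀ ε, (diffOp hab (A ε) - diffOp hab A₀) (Pi.single k u) i
        = (∑ j' ∈ Finset.univ.filter (fun j' : Fin r => j' < j),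
            mulCLM hab (A ε j' i k - A₀ j' i k) (derivCLM (j := (j' : ℕ)) (by omega) u))
          + (A ε j i k - A₀ j i k) := by
      intro ε
      rw [diffOp_sub_apply]
      have e1 : ∀ j' : Fin r, ∑ k' : Fin m, mulCLM hab (A ε j' i k' - A₀ j' i k')
          (derivCLM (j := (j' : ℕ)) (l := n + 1) (by omega)
            ((Pi.single k u : VecSobolev a b p (n + r) m) k'))
          = mulCLM hab (A ε j' i k - A₀ j' i k) (derivCLM (j := (j' : ℕ)) (by omega) u) := by
        intro j'
        rw [Fintype.sum_eq_single k fun k' hk' => by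
          rw [Pi.single_eq_of_ne hk', map_zero, map_zero], Pi.single_eq_same]
      simp only [e1]
      rw [← Finset.sum_filter_add_sum_filter_not Finset.univ (fun j' : Fin r => j' < j)]
      congr 1
      rw [Finset.sum_eq_single j]
      · refine ext_ae ?_
        filter_upwards [coeFn_mulCLM hab (A ε j i k - A₀ j i k)
          (derivCLM (j := (j : ℕ)) (by omega) u), hu1 (by omega)] with t h1 h2
        rw [h1, toLp_derivCLM, h2, mul_one]
      · intro j' hj' hne
        have hlt : (j : ℕ) < j' := by
          have := (Finset.mem_filter.1 hj').2
          exact lt_of_le_of_ne (not_lt.1 this) (fun h => hne (Fin.ext h.symm))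
        have hz : derivCLM (j := (j' : ℕ)) (l := n + 1) (by omega) u = 0 :=
          toLp_injective (by rw [toLp_derivCLM, hu0 _ hlt (by omega), map_zero])
        rw [hz, map_zero]
      · simp
    have h1 : (fun ε => (diffOp hab (A ε) - diffOp hab A₀) (Pi.single k u) i) =o[l] g :=
      ((ContinuousLinearMap.proj (R := ℂ) (φ := fun _ : Fin m => SobolevSpace a b p n)
        i).isBigO_comp _ _).trans_isLittleO (h (Pi.single k u))
    have h2 : (fun ε => ∑ j' ∈ Finset.univ.filter (fun j' : Fin r => j' < j),
        mulCLM hab (A ε j' i k - A₀ j' i k) (derivCLM (j := (j' : ℕ)) (by omega) u)) =o[l] g := by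
      refine IsLittleO.fun_sum fun j' hj' => ?_
      exact (((mulCLM hab).flip (derivCLM (j := (j' : ℕ)) (by omega) u)).isBigO_comp _ _).trans_isLittleO
        (ih j' (Finset.mem_filter.1 hj').2 j' rfl)
    refine (h1.sub h2).congr_left fun ε => ?_
    rw [hval ε, add_sub_cancel_left]

open Asymptotics in
/-- If the coefficients depend on the parameter so that `L(ε) y₀` is close to `L(0) y₀` up to
a factor that grows at most linearly with the coefficients, then the coefficients converge. -/
lemma tendsto_coeff_of_isLittleO (hab : a < b) {l : Filter ℝ}
    {A : ℝ → Fin r → MatSobolev a b p n m} {A₀ : Fin r → MatSobolev a b p n m}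
    (h : ∀ y, (fun ε => (diffOp hab (A ε) - diffOp hab A₀) y) =o[l]
      fun ε => 1 + coeffDist (A ε) A₀) (j : Fin r) :
    Tendsto (fun ε => A ε j) l (𝓝 (A₀ j)) := by
  have hd : ∀ i (j : Fin r) k, (fun ε => A ε j i k - A₀ j i k) =o[l]
      fun ε => 1 + coeffDist (A ε) A₀ := fun i j k => isLittleO_coeff hab h i k j j rfl
  have ha : (fun ε => coeffDist (A ε) A₀) =o[l] fun ε => 1 + coeffDist (A ε) A₀ :=
    IsLittleO.fun_sum fun i _ => IsLittleO.fun_sum fun j _ => IsLittleO.fun_sum fun k _ => (hd i j k).norm_left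
  -- Eventually `coeffDist ≤ (1 + coeffDist) / 2`, that is `coeffDist ≤ 1`; hence the bound `2`.
  have hb : (fun ε => 1 + coeffDist (A ε) A₀) =O[l] fun _ => (1 : ℝ) := by
    refine IsBigO.of_bound 2 ?_
    filter_upwards [ha.bound (show (0 : ℝ) < 1 / 2 by norm_num)] with ε hε
    have h0 := coeffDist_nonneg (A ε) A₀
    rw [Real.norm_of_nonneg h0, Real.norm_of_nonneg (by linarith)] at hε
    rw [Real.norm_of_nonneg (by linarith), norm_one]
    linarith
  rw [tendsto_matSobolev_iff]
  intro i k
  rw [tendsto_iff_norm_sub_tendsto_zero]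
  exact ((isLittleO_one_iff ℝ).1 ((hd i j k).trans_isBigO hb)).norm.trans (by simp)

end Coefficients

/-- An injective `Q₀` on a finite-dimensional space satisfies `‖c‖ ≤ K * ‖Q₀ c‖`. A perturbation of
norm below `1 / (2 * K)` keeps this bound with `2 * K`. -/
lemma tendsto_of_tendsto_clm_apply {E : Type*} [NormedAddCommGroup E] [NormedSpace ℂ E] {N : ℕ}
    {ι : Type*} {l : Filter ι} {Q : ι → (Fin N → ℂ) →L[ℂ] E} {Q₀ : (Fin N → ℂ) →L[ℂ] E}
    (hQ : Tendsto Q l (𝓝 Q₀)) (hinj : Function.Injective Q₀) {x : ι → Fin N → ℂ} {x₀ : Fin N → ℂ}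
    (h : Tendsto (fun i => Q i (x i)) l (𝓝 (Q₀ x₀))) : Tendsto x l (𝓝 x₀) := by
  obtain ⟨K, hK, hanti⟩ := (Q₀ : (Fin N → ℂ) →ₗ[ℂ] E).exists_antilipschitzWith
    (LinearMap.ker_eq_bot.2 hinj)
  have hK' : (0 : ℝ) < K := hK
  have hlow : ∀ c, ‖c‖ ≤ K * ‖Q₀ c‖ := fun c =>
    by simpa [dist_eq_norm] using hanti.le_mul_dist c 0
  have hsmall : ∀ᶠ i in l, ‖Q i - Q₀‖ < 1 / (2 * K) := by
    have := tendsto_iff_norm_sub_tendsto_zero.1 hQ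
    exact this.eventually_lt_const (by positivity)
  have h0 : Tendsto (fun i => Q i (x i - x₀)) l (𝓝 0) := by
    simpa using h.sub (tendsto_clm_apply hQ (tendsto_const_nhds (x := x₀)))
  rw [tendsto_iff_norm_sub_tendsto_zero]
  refine squeeze_zero' (g := fun i => 2 * K * ‖Q i (x i - x₀)‖)
    (Eventually.of_forall fun _ => norm_nonneg _) ?_ (by simpa using h0.norm.const_mul (2 * (K : ℝ)))
  filter_upwards [hsmall] with i hi
  set c := x i - x₀
  have h1 : ‖Q₀ c‖ ≤ ‖Q i c‖ + 1 / (2 * K) * ‖c‖ := by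
    have e : Q₀ c = Q i c - (Q i - Q₀) c := by rw [sub_apply]; abel
    rw [e]
    exact (norm_sub_le _ _).trans (by gcongr; exact (Q i - Q₀).le_of_opNorm_le hi.le c)
  have h2 := (hlow c).trans (mul_le_mul_of_nonneg_left h1 hK'.le)
  have h3 : K * (‖Q i c‖ + 1 / (2 * K) * ‖c‖) = K * ‖Q i c‖ + ‖c‖ / 2 := by
    field_simp
  linarith

/-! ### The two implications. -/

section Main

variable {a b : ℝ} {p : ℝ≥0∞} [Fact (1 ≤ p)] {n m r : ℕ}

theorem dependsContinuously_of_tendsto (hab : a < b) {ε₀ : ℝ} (hε₀ : 0 < ε₀)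
    {A : ℝ → Fin r → MatSobolev a b p n m}
    {B : ℝ → (VecSobolev a b p (n + r) m →L[ℂ] (Fin (r * m) → ℂ))}
    (h0 : OnlyTrivialSolution (A 0) (B 0))
    (hA : ∀ j : Fin r, Tendsto (fun ε => A ε j) (𝓝[>] 0) (𝓝 (A 0 j)))
    (hB : ∀ y, Tendsto (fun ε => B ε y) (𝓝[>] 0) (𝓝 (B 0 y))) :
    DependsContinuously ε₀ A B := by
  obtain ⟨hbij, hconv⟩ := eventually_bijective_and_tendsto (h0.bijective hab)
    (tendsto_diffOp hab hA) hB
  obtain ⟨δ, hδ, hsub⟩ := mem_nhdsGT_iff_exists_Ioo_subset.1 hbij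
  have hδ' : 0 < δ := hδ
  -- Halving `ε₀` makes the inequality `ε₁ < ε₀` strict. The point `ε = 0` is invisible to `𝓝[>] 0`
  -- and is treated separately by `h0`.
  refine ⟨min δ (ε₀ / 2), lt_min hδ' (by linarith), (min_le_right _ _).trans_lt (by linarith),
    fun ε hε f c => ?_, fun f c y hy hf hc => ?_⟩
  · have hb : Function.Bijective ((diffOp hab (A ε)).prod (B ε)) := by
      rcases hε.1.eq_or_lt with rfl | hpos
      · exact h0.bijective hab
      · exact hsub ⟨hpos, hε.2.trans_le (min_le_left _ _)⟩
    simpa [isSolution_iff hab, Prod.ext_iff] using hb.existsUnique (f, c)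
  · have hpos : 0 < min δ (ε₀ / 2) := lt_min hδ' (by linarith)
    have hy0 := (isSolution_iff hab).1 (hy 0 ⟨le_rfl, hpos⟩)
    refine hconv f (f 0) c (c 0) y (y 0) hf hc ?_ hy0.1 hy0.2
    filter_upwards [Ioo_mem_nhdsGT hpos] with ε hε
    exact (isSolution_iff hab).1 (hy ε ⟨hε.1.le, hε.2⟩)

namespace DependsContinuously

variable {ε₀ : ℝ} {A : ℝ → Fin r → MatSobolev a b p n m}
  {B : ℝ → (VecSobolev a b p (n + r) m →L[ℂ] (Fin (r * m) → ℂ))}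

/-- A solution operator for small values of the parameter. -/
lemma exists_solution_operator (hab : a < b) (h : DependsContinuously ε₀ A B) :
    ∃ (ε₁ : ℝ) (sol : ℝ → VecSobolev a b p n m → (Fin (r * m) → ℂ) → VecSobolev a b p (n + r) m),
      0 < ε₁ ∧
      (∀ ε ∈ Ico 0 ε₁, ∀ f c y, diffOp hab (A ε) y = f ∧ B ε y = c ↔ y = sol ε f c) ∧
      ∀ f c, Tendsto f (𝓝[>] 0) (𝓝 (f 0)) → Tendsto c (𝓝[>] 0) (𝓝 (c 0)) →
        Tendsto (fun ε => sol ε (f ε) (c ε)) (𝓝[>] 0) (𝓝 (sol 0 (f 0) (c 0))) := by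
  obtain ⟨ε₁, h1, -, hex, hconv⟩ := h
  -- Outside `[0, ε₁)` the values of `sol` are arbitrary, which does not affect the limit at `0+`.
  choose! sol hsol huniq using hex
  refine ⟨ε₁, sol, h1, fun ε hε f c y => ?_, fun f c hf hc =>
    hconv f c _ (fun ε hε => hsol ε hε (f ε) (c ε)) hf hc⟩
  rw [← isSolution_iff hab]
  refine ⟨fun hy => huniq ε hε f c y hy, ?_⟩
  rintro rfl
  exact hsol ε hε f c

theorem onlyTrivialSolution (hab : a < b) (h : DependsContinuously ε₀ A B) :
    OnlyTrivialSolution (A 0) (B 0) := by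
  obtain ⟨ε₁, h1, -, hex, -⟩ := h
  intro y hy
  refine (hex 0 ⟨le_rfl, h1⟩ 0 0).unique hy ((isSolution_iff hab).2 ⟨map_zero _, map_zero _⟩)

open Asymptotics in
theorem tendsto_coeff (hab : a < b) (h : DependsContinuously ε₀ A B) (j : Fin r) :
    Tendsto (fun ε => A ε j) (𝓝[>] 0) (𝓝 (A 0 j)) := by
  obtain ⟨ε₁, sol, h1, hsol, hconv⟩ := h.exists_solution_operator hab
  refine tendsto_coeff_of_isLittleO hab (fun y => ?_) j
  set L₀ := diffOp hab (A 0) with hL₀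
  have hy0 : sol 0 (L₀ y) (B 0 y) = y := ((hsol 0 ⟨le_rfl, h1⟩ _ _ y).1 ⟨rfl, rfl⟩).symm
  have hy := hconv (fun _ => L₀ y) (fun _ => B 0 y) tendsto_const_nhds tendsto_const_nhds
  simp only [hy0] at hy
  have hη : Tendsto (fun ε => (‖L₀‖ + ‖mulCLM (p := p) (n := n) hab‖)
      * ‖sol ε (L₀ y) (B 0 y) - y‖) (𝓝[>] 0) (𝓝 0) := by
    simpa using (tendsto_iff_norm_sub_tendsto_zero.1 hy).const_mul
      (‖L₀‖ + ‖mulCLM (p := p) (n := n) hab‖)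
  refine isLittleO_iff.2 fun c hc => ?_
  filter_upwards [hη.eventually_lt_const hc, Ioo_mem_nhdsGT h1] with ε hε hm
  set w := sol ε (L₀ y) (B 0 y) with hw
  have hLw : diffOp hab (A ε) w = L₀ y := ((hsol ε ⟨hm.1.le, hm.2⟩ _ _ w).2 rfl).1
  -- This rearranges `L(ε)w = L(0)y`. Every term on the right contains the small factor `w - y`.
  have e : (diffOp hab (A ε) - L₀) y = -(L₀ (w - y)) - (diffOp hab (A ε) - L₀) (w - y) := by
    simp only [sub_apply, map_sub, hLw]
    abel
  have ha := coeffDist_nonneg (A ε) (A 0)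
  rw [Real.norm_of_nonneg (by linarith), e]
  calc ‖-(L₀ (w - y)) - (diffOp hab (A ε) - L₀) (w - y)‖
      ≤ ‖L₀‖ * ‖w - y‖ + ‖mulCLM (p := p) (n := n) hab‖ * coeffDist (A ε) (A 0) * ‖w - y‖ := by
        refine (norm_sub_le _ _).trans (add_le_add ?_ (norm_diffOp_sub_apply_le hab _ _ _))
        rw [norm_neg]
        exact L₀.le_opNorm _
    _ ≤ ((‖L₀‖ + ‖mulCLM (p := p) (n := n) hab‖) * ‖w - y‖) * (1 + coeffDist (A ε) (A 0)) := by
        have h2 : 0 ≤ ‖L₀‖ * ‖w - y‖ * coeffDist (A ε) (A 0) := by positivity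
        have h3 : 0 ≤ ‖mulCLM (p := p) (n := n) hab‖ * ‖w - y‖ := by positivity
        linarith
    _ ≤ c * (1 + coeffDist (A ε) (A 0)) := by gcongr

theorem tendsto_boundary (hab : a < b) (h : DependsContinuously ε₀ A B)
    (y : VecSobolev a b p (n + r) m) : Tendsto (fun ε => B ε y) (𝓝[>] 0) (𝓝 (B 0 y)) := by
  have hA := tendsto_diffOp hab (h.tendsto_coeff hab)
  obtain ⟨ε₁, sol, h1, hsol, hconv⟩ := h.exists_solution_operator hab
  -- For `ε` in `[0, ε₁)`, `Q ε c` is the solution of the homogeneous equation with boundary data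
  -- `c`. It is built from a basis of data, so norm convergence need only be checked on that basis.
  set Q : ℝ → (Fin (r * m) → ℂ) →L[ℂ] VecSobolev a b p (n + r) m := fun ε =>
    (Fintype.linearCombination ℂ fun k => sol ε 0 (Pi.single k 1)).toContinuousLinearMap with hQ
  have hQa : ∀ ε c, Q ε c = ∑ k, c k • sol ε 0 (Pi.single k 1) := fun ε c => by
    simp [hQ, Fintype.linearCombination_apply]
  have hQs : ∀ ε ∈ Ico 0 ε₁, ∀ c, diffOp hab (A ε) (Q ε c) = 0 ∧ B ε (Q ε c) = c := by
    intro ε hε c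
    have hs : ∀ k, _ := fun k => (hsol ε hε 0 (Pi.single k 1) _).2 rfl
    rw [hQa, map_sum, map_sum]
    constructor
    · exact Finset.sum_eq_zero fun k _ => by rw [map_smul, (hs k).1, smul_zero]
    · conv_rhs => rw [pi_eq_sum_univ' c]
      exact Finset.sum_congr rfl fun k _ => by rw [map_smul, (hs k).2]
  have hQt : Tendsto Q (𝓝[>] 0) (𝓝 (Q 0)) := by
    refine tendsto_clm_of_strong fun k => ?_
    have e : ∀ ε, Q ε (Pi.single k 1) = sol ε 0 (Pi.single k 1) := fun ε => by
      simp [hQ, Fintype.linearCombination_apply_single]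
    simp only [e]
    exact hconv (fun _ => 0) (fun _ => Pi.single k 1) tendsto_const_nhds tendsto_const_nhds
  have h0 : (0 : ℝ) ∈ Ico 0 ε₁ := ⟨le_rfl, h1⟩
  -- By uniqueness, `y` is the sum of the solutions with data `(0, B(ε)y)` and `(L(ε)y, 0)`.
  have hQB : ∀ ε ∈ Ico 0 ε₁, Q ε (B ε y) = y - sol ε (diffOp hab (A ε) y) 0 := by
    intro ε hε
    rw [eq_sub_iff_add_eq', ← eq_sub_iff_add_eq, eq_comm, ← hsol ε hε, map_sub, map_sub,
      (hQs ε hε _).1, (hQs ε hε _).2]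
    simp
  have hinj : Function.Injective (Q 0) := fun c c' hcc => by
    rw [← (hQs 0 h0 c).2, hcc, (hQs 0 h0 c').2]
  refine tendsto_of_tendsto_clm_apply hQt hinj ?_
  rw [hQB 0 h0]
  have hlim := (tendsto_const_nhds (x := y)).sub
    (hconv (fun ε => diffOp hab (A ε) y) (fun _ => 0)
      (tendsto_clm_apply hA tendsto_const_nhds) tendsto_const_nhds)
  refine hlim.congr' ?_
  filter_upwards [Ioo_mem_nhdsGT h1] with ε hε
  exact (hQB ε ⟨hε.1.le, hε.2⟩).symm

end DependsContinuously

end Main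

end SobolevBVP

end

theorem theorem1 {a b : ℝ} (hab : a < b) {p : ℝ≥0∞} [Fact (1 ≤ p)] {n m r : ℕ}
    (hm : 1 ≤ m) (hr : 1 ≤ r) {ε₀ : ℝ} (hε₀ : 0 < ε₀)
    (A : ℝ → Fin r → SobolevBVP.MatSobolev a b p n m)
    (B : ℝ → (SobolevBVP.VecSobolev a b p (n + r) m →L[ℂ] (Fin (r * m) → ℂ))) :
    SobolevBVP.DependsContinuously ε₀ A B ↔
      SobolevBVP.OnlyTrivialSolution (A 0) (B 0) ∧
      (∀ j : Fin r, Tendsto (fun ε => A ε j) (𝓝[>] 0) (𝓝 (A 0 j))) ∧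
      (∀ y : SobolevBVP.VecSobolev a b p (n + r) m,
        Tendsto (fun ε => B ε y) (𝓝[>] 0) (𝓝 (B 0 y))) := by
  constructor
  · intro h
    exact ⟨h.onlyTrivialSolution hab, h.tendsto_coeff hab, h.tendsto_boundary hab⟩
  · rintro ⟨h0, hA, hB⟩
    exact SobolevBVP.dependsContinuously_of_tendsto hab hε₀ h0 hA hB
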